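/- Let $m,n\ge 1$ be integers and $\rho\in(0,1)$. For an entire (holomorphic) map $f=(f^1,\dots,f^n):\mathbb{C}^m\to\mathbb{C}^n$ let $M(r;f)=\sup_{\|z\|=r}\|f(z)\|$ (Euclidean norms) and define its order as $\limsup_{r\to\infty}\frac{\log\log M(r;f)}{\log r}$. For $\zeta$ in the unit sphere $S$ of $\mathbb{C}^m$ let $f^j_\zeta(z)=f^j(z\zeta)$, $z\in\mathbb{C}$, be the slice functions, let $M(r,f^j_\zeta)=\sup_{|z|=r}|f^j_\zeta(z)|$, and, when $f^j_\zeta(0)\neq 0$, let $N(r,1/f^j_\zeta)=\int_0^r \frac{n(t,1/f^j_\zeta)}{t}\,dt$, where $n(t,1/f^j_\zeta)$ is the number of zeros of $f^j_\zeta$ in $|z|\le t$, counted with multiplicity. Put $$N_{\max}(r)=\max_{1\le j\le n}\,\sup_{\zeta\in S}N(r,1/f^j_\zeta),\qquad M_{\max}(r)=\max_{1\le j\le n}\,\sup_{\zeta\in S}M(r,f^j_\zeta).$$ If $f$ is entire of order $\rho$ and $f(0)=(1,\dots,1)$, then $$\limsup_{r\to\infty}\frac{N_{\max}(r)}{\log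 M_{\max}(r)}\ \ge\ \frac{\sin\pi\rho}{\pi\rho}.$$ This is best possible: for all $m,n\ge1$ and every $\rho\in(0,1)$ there is an entire map $f:\mathbb{C}^m\to\mathbb{C}^n$ of order $\rho$ with $f(0)=(1,\dots,1)$ for which equality holds. -/

import Mathlib

/-- The maximum modulus `M(r; f) = sup_{‖z‖ = r} ‖f z‖`. For a continuous `f` on a finite
dimensional space this is a supremum of a bounded set of reals. -/
noncomputable def maxModulus {E F : Type*} [NormedAddCommGroup E] [NormedAddCommGroup F]
    (f : E → F) (r : ℝ) : ℝ :=
  ⨆ z : Metric.sphere (0 : E) r, ‖f z‖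

/-- The order `limsup_{r → ∞} log log M(r; f) / log r` of an entire function, as an extended
real number. -/
noncomputable def entireOrder {E F : Type*} [NormedAddCommGroup E] [NormedAddCommGroup F]
    (f : E → F) : EReal :=
  Filter.limsup
    (fun r : ℝ => ((Real.log (Real.log (maxModulus f r)) / Real.log r : ℝ) : EReal))
    Filter.atTop

/-- The slice `z ↦ f^j (z ζ)` of the `j`-th component of `f : ℂ^m → ℂ^n` in direction `ζ`. -/
def compSlice {m n : ℕ} (f : EuclideanSpace ℂ (Fin m) → EuclideanSpace ℂ (Fin n))
    (j : Fin n) (ζ : EuclideanSpace ℂ (Fin m)) : ℂ → ℂ :=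
  fun z => f (z • ζ) j

/-- `N_max(r) = max_j sup_{‖ζ‖ = 1} N(r, 1 / f^j_ζ)`. Here `ValueDistribution.logCounting g 0` is
the Nevanlinna (logarithmic) counting function, with multiplicity, of the zeros of `g`. If `f` is
entire with `f^j(0) = 1` for all `j`, the suprema are over bounded sets, by Jensen's formula. -/
noncomputable def countingMax {m n : ℕ}
    (f : EuclideanSpace ℂ (Fin m) → EuclideanSpace ℂ (Fin n)) (r : ℝ) : ℝ :=
  ⨆ j : Fin n, ⨆ ζ : Metric.sphere (0 : EuclideanSpace ℂ (Fin m)) 1,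
    ValueDistribution.logCounting (compSlice f j ζ) 0 r

/-- `M_max(r) = max_j sup_{‖ζ‖ = 1} M(r, f^j_ζ)`. -/
noncomputable def modulusMax {m n : ℕ}
    (f : EuclideanSpace ℂ (Fin m) → EuclideanSpace ℂ (Fin n)) (r : ℝ) : ℝ :=
  ⨆ j : Fin n, ⨆ ζ : Metric.sphere (0 : EuclideanSpace ℂ (Fin m)) 1,
    maxModulus (compSlice f j ζ) r

/-- `limsup_{r → ∞} N_max(r) / log M_max(r)`, as an extended real number. -/
noncomputable def growthRatio {m n : ℕ}
    (f : EuclideanSpace ℂ (Fin m) → EuclideanSpace ℂ (Fin n)) : EReal :=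
  Filter.limsup
    (fun r : ℝ => ((countingMax f r / Real.log (modulusMax f r) : ℝ) : EReal)) Filter.atTop

/-!
Write `σ = sin (π ρ) / (π ρ)`. For `0 < p < 1` the average of `t ^ p` over `(0, ∞)` against the
probability kernel `r / (t + r) ^ 2` is `gammaConst p * r ^ p`, where
`gammaConst p = Γ(1 + p) Γ(1 - p) = π p / sin (π p)`, so that `σ = 1 / gammaConst ρ`. The average of
`log⁺ (t b)`, the counting function of one zero of modulus `1 / b`, is `log (1 + r b)`, the
logarithm of the largest modulus on `|z| = r` of the corresponding factor. Since an entire function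
of order less than one is the product of such factors, a bound `A + B t ^ p` for its counting
function bounds the logarithm of its maximum modulus by `A + B * gammaConst p * r ^ p`
(`norm_le_exp_of_logCounting_le`). Infinite products are avoided there: the zeros in a disc of
radius `R` are divided out, and the zero-free quotient is estimated by the Borel–Carathéodory
theorem; its contribution vanishes as `R → ∞`.

For the lower bound, suppose that the limit superior is smaller than `σ`. For some `p > ρ` and some
`c < 1` with `c * gammaConst p < 1`, eventually `N_max ≤ c log M_max`. A bound
`K + q t ^ p` for `log M_max` then gives, on each slice and with constants uniform in the slice,
the bound `K + q * (c * gammaConst p) * t ^ p`. Iterating, `log M_max` is bounded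
(`exists_norm_le_of_countingMax_le`), so the map is constant by Liouville's theorem and has order
`0`, not `ρ`.

For the sharpness, every component is taken to be the canonical product with the zeros
`-k ^ (1 / ρ)`, as a function of the first coordinate. Its counting function is at most
`r ^ ρ / ρ`, because `X ^ N / N! ≤ exp X`. Its value at `r` has logarithm asymptotic to
`gammaConst ρ * r ^ ρ / ρ`, because for positive arguments the averages above are exact and the
counting function is `r ^ ρ / ρ` up to lower order terms by Stirling's formula.
-/

open Set MeasureTheory Filter Topology
open Real (posLog circleAverage)

/-! ### Averages against the kernel `r / (t + r) ^ 2` -/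

/-- The constant `Γ(1 + p) Γ(1 - p)`, equal to `π p / sin (π p)` for `0 < p < 1` and to `1` for
`p = 0`. It is the factor by which averaging against `r / (t + r) ^ 2` multiplies `t ^ p`. -/
noncomputable def gammaConst (p : ℝ) : ℝ := Real.Gamma (1 + p) * Real.Gamma (1 - p)

theorem gammaConst_zero : gammaConst 0 = 1 := by simp [gammaConst]

theorem gammaConst_eq {p : ℝ} (hp : 0 < p) :
    gammaConst p = Real.pi * p / Real.sin (Real.pi * p) := by
  rw [gammaConst, add_comm, Real.Gamma_add_one hp.ne', mul_assoc, Real.Gamma_mul_Gamma_one_sub]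
  ring

theorem gammaConst_pos {p : ℝ} (h0 : 0 ≤ p) (h1 : p < 1) : 0 < gammaConst p :=
  mul_pos (Real.Gamma_pos_of_pos (by linarith)) (Real.Gamma_pos_of_pos (by linarith))

theorem continuousAt_gammaConst {p : ℝ} (h0 : 0 < p) (h1 : p < 1) :
    ContinuousAt gammaConst p := by
  have key : ∀ x : ℝ, 0 < x → ContinuousAt Real.Gamma x := fun x hx =>
    (Real.differentiableAt_Gamma fun m => by
      have : (0 : ℝ) ≤ m := m.cast_nonneg
      linarith).continuousAt
  unfold gammaConst
  refine ContinuousAt.mul ?_ ?_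
  · exact ContinuousAt.comp (g := Real.Gamma) (f := fun p => 1 + p) (key _ (by linarith))
      (by fun_prop)
  · exact ContinuousAt.comp (g := Real.Gamma) (f := fun p => 1 - p) (key _ (by linarith))
      (by fun_prop)

theorem image_div_one_add : (fun u : ℝ => u / (1 + u)) '' Ioi 0 = Ioo 0 1 := by
  ext x
  simp only [mem_image, mem_Ioi, mem_Ioo]
  constructor
  · rintro ⟨u, hu, rfl⟩
    exact ⟨by positivity, by rw [div_lt_one (by positivity)]; linarith⟩
  · rintro ⟨h0, h1⟩
    refine ⟨x / (1 - x), div_pos h0 (by linarith), ?_⟩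
    have : 1 - x ≠ 0 := by linarith
    field_simp
    ring

theorem injOn_div_one_add : InjOn (fun u : ℝ => u / (1 + u)) (Ioi 0) := by
  intro a ha b hb h
  simp only [mem_Ioi] at ha hb
  simp only at h
  rw [div_eq_div_iff (by positivity) (by positivity)] at h
  linarith

theorem hasDerivAt_div_one_add {u : ℝ} (hu : 0 < u) :
    HasDerivAt (fun u : ℝ => u / (1 + u)) (1 / (1 + u) ^ 2) u := by
  have h := (hasDerivAt_id u).div ((hasDerivAt_id u).const_add 1)
    (by simp only [id]; positivity : 1 + id u ≠ 0)
  convert! h using 1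
  simp

theorem rpow_mul_one_sub_rpow_eq {p u : ℝ} (hu : 0 < u) :
    |1 / (1 + u) ^ 2| • ((u / (1 + u)) ^ p * (1 - u / (1 + u)) ^ (-p))
      = u ^ p * (1 / (u + 1) ^ 2) := by
  have h1 : 1 - u / (1 + u) = (1 + u)⁻¹ := by field_simp; ring
  rw [abs_of_nonneg (by positivity), h1, Real.inv_rpow (by positivity),
    Real.rpow_neg (by positivity), inv_inv, Real.div_rpow hu.le (by positivity), smul_eq_mul,
    add_comm 1 u]
  have : (u + 1) ^ p ≠ 0 := (Real.rpow_pos_of_pos (by positivity) _).ne'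
  field_simp

theorem integrableOn_beta {p : ℝ} (h0 : 0 ≤ p) (h1 : p < 1) :
    IntegrableOn (fun x : ℝ => x ^ p * (1 - x) ^ (-p)) (Ioo 0 1) ∧
      ∫ x in Ioo (0 : ℝ) 1, x ^ p * (1 - x) ^ (-p) = gammaConst p := by
  have hu : 0 < (1 + p : ℂ).re := by simp; linarith
  have hv : 0 < (1 - p : ℂ).re := by simp; linarith
  have hconv := Complex.betaIntegral_convergent hu hv
  have hval := Complex.Gamma_mul_Gamma_eq_betaIntegral hu hv
  have e2 : (1 + p : ℂ) + (1 - p) = ((1 : ℕ) : ℂ) + 1 := by push_cast; ring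
  rw [e2, Complex.Gamma_nat_eq_factorial] at hval
  simp only [Nat.factorial, Nat.cast_one, one_mul, mul_one] at hval
  rw [intervalIntegrable_iff_integrableOn_Ioo_of_le zero_le_one] at hconv
  have heq : EqOn (fun x : ℝ => (x : ℂ) ^ ((1 + p : ℂ) - 1) * (1 - (x : ℂ)) ^ ((1 - p : ℂ) - 1))
      (fun x : ℝ => ((x ^ p * (1 - x) ^ (-p) : ℝ) : ℂ)) (Ioo 0 1) := by
    intro x hx
    simp only
    rw [Complex.ofReal_mul, Complex.ofReal_cpow hx.1.le, Complex.ofReal_cpow (by linarith [hx.2])]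
    congr 2
    · ring
    · push_cast; ring
    · push_cast; ring
  have hint : IntegrableOn (fun x : ℝ => x ^ p * (1 - x) ^ (-p)) (Ioo 0 1) := by
    have := (integrableOn_congr_fun heq measurableSet_Ioo).1 hconv
    simpa [IntegrableOn] using this.re
  refine ⟨hint, ?_⟩
  have : Complex.betaIntegral (1 + p) (1 - p)
      = ((∫ x in Ioo (0 : ℝ) 1, x ^ p * (1 - x) ^ (-p) : ℝ) : ℂ) := by
    rw [Complex.betaIntegral, intervalIntegral.integral_of_le zero_le_one,
      integral_Ioc_eq_integral_Ioo, setIntegral_congr_fun measurableSet_Ioo heq,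
      integral_complex_ofReal]
  rw [this] at hval
  have h3 : (1 : ℂ) + p = ((1 + p : ℝ) : ℂ) := by push_cast; ring
  have h4 : (1 : ℂ) - p = ((1 - p : ℝ) : ℂ) := by push_cast; ring
  rw [h3, h4, Complex.Gamma_ofReal, Complex.Gamma_ofReal] at hval
  exact_mod_cast hval.symm

/-- The substitution `x = u / (1 + u)` turns the integral into the beta integral
`B(1 + p, 1 - p)`. -/
theorem integral_rpow_mul_kernel_one {p : ℝ} (h0 : 0 ≤ p) (h1 : p < 1) :
    IntegrableOn (fun u : ℝ => u ^ p * (1 / (u + 1) ^ 2)) (Ioi 0) ∧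
      ∫ u in Ioi (0 : ℝ), u ^ p * (1 / (u + 1) ^ 2) = gammaConst p := by
  obtain ⟨hi, hv⟩ := integrableOn_beta h0 h1
  have hd : ∀ u ∈ Ioi (0 : ℝ), HasDerivWithinAt (fun u : ℝ => u / (1 + u))
      (1 / (1 + u) ^ 2) (Ioi 0) u := fun u hu => (hasDerivAt_div_one_add hu).hasDerivWithinAt
  rw [← image_div_one_add] at hi hv
  constructor
  · have := (integrableOn_image_iff_integrableOn_abs_deriv_smul measurableSet_Ioi hd
      injOn_div_one_add _).1 hi
    exact (integrableOn_congr_fun (fun u hu => rpow_mul_one_sub_rpow_eq hu)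
      measurableSet_Ioi).1 this
  · rw [← hv, integral_image_eq_integral_abs_deriv_smul measurableSet_Ioi hd injOn_div_one_add]
    exact (setIntegral_congr_fun measurableSet_Ioi
      (fun u hu => rpow_mul_one_sub_rpow_eq hu)).symm

theorem integrableOn_rpow_mul_kernel {p r : ℝ} (h0 : 0 ≤ p) (h1 : p < 1) (hr : 0 < r) :
    IntegrableOn (fun t : ℝ => t ^ p * (r / (t + r) ^ 2)) (Ioi 0) ∧
      ∫ t in Ioi (0 : ℝ), t ^ p * (r / (t + r) ^ 2) = gammaConst p * r ^ p := by
  obtain ⟨hi, hv⟩ := integral_rpow_mul_kernel_one h0 h1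
  have heq : EqOn (fun t : ℝ => r ^ (p - 1) * ((r⁻¹ * t) ^ p * (1 / (r⁻¹ * t + 1) ^ 2)))
      (fun t : ℝ => t ^ p * (r / (t + r) ^ 2)) (Ioi 0) := by
    intro t ht
    have ht : 0 < t := ht
    have hrp : r ^ p ≠ 0 := (Real.rpow_pos_of_pos hr _).ne'
    simp only
    rw [Real.mul_rpow (by positivity) ht.le, Real.inv_rpow hr.le, Real.rpow_sub_one hr.ne']
    field_simp
  constructor
  · refine (integrableOn_congr_fun heq measurableSet_Ioi).1 (Integrable.const_mul ?_ _)
    have := (integrableOn_Ioi_comp_mul_left_iff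
      (fun u : ℝ => u ^ p * (1 / (u + 1) ^ 2)) 0 (inv_pos.2 hr)).2 (by simpa using hi)
    exact this
  · rw [← setIntegral_congr_fun measurableSet_Ioi heq, integral_const_mul,
      integral_comp_mul_left_Ioi (fun u : ℝ => u ^ p * (1 / (u + 1) ^ 2)) 0 (inv_pos.2 hr),
      mul_zero, hv, Real.rpow_sub_one hr.ne', inv_inv, smul_eq_mul]
    field_simp

/-- A function with a single simple zero at distance `1 / b` from the origin has counting function
`log⁺ (t b)`; the average of the latter is `log (1 + r b)`, because
`-r / (t + r) * log (t b) + log (t / (t + r))` is an antiderivative on `[1 / b, ∞)`. -/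
theorem integrableOn_posLog_mul_kernel {b r : ℝ} (hb : 0 ≤ b) (hr : 0 < r) :
    IntegrableOn (fun t : ℝ => posLog (t * b) * (r / (t + r) ^ 2)) (Ioi 0) ∧
      ∫ t in Ioi (0 : ℝ), posLog (t * b) * (r / (t + r) ^ 2) = Real.log (1 + r * b) := by
  rcases hb.eq_or_lt with rfl | hb
  · simp
  have ha : 0 < b⁻¹ := inv_pos.2 hb
  set F : ℝ → ℝ := fun t => -(r / (t + r) * Real.log (t * b)) + (Real.log t - Real.log (t + r))
    with hF
  have hderiv : ∀ t ∈ Ici b⁻¹, HasDerivAt F (Real.log (t * b) * (r / (t + r) ^ 2)) t := by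
    intro t ht
    have ht0 : 0 < t := ha.trans_le ht
    have e1 : HasDerivAt (fun t : ℝ => r / (t + r)) (-r / (t + r) ^ 2) t := by
      have := (hasDerivAt_const t r).div ((hasDerivAt_id t).add_const r)
        (by simp only [id]; positivity)
      convert! this using 1
      simp
    have e2 : HasDerivAt (fun t : ℝ => Real.log (t * b)) (1 / t) t := by
      have := ((hasDerivAt_id t).mul_const b).log (by simp only [id]; positivity)
      convert! this using 1
      simp only [id]
      field_simp
    have e3 := (Real.hasDerivAt_log ht0.ne').sub
      (((hasDerivAt_id t).add_const r).log (by simp only [id]; positivity))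
    have := (e1.mul e2).neg.add e3
    convert! this using 1
    simp only [id]
    field_simp
    ring
  have hnonneg : ∀ t ∈ Ioi b⁻¹, 0 ≤ Real.log (t * b) * (r / (t + r) ^ 2) := by
    intro t ht
    have ht0 : 0 < t := ha.trans ht
    have : 1 ≤ t * b := by
      have := mul_le_mul_of_nonneg_right (le_of_lt ht) hb.le
      rwa [inv_mul_cancel₀ hb.ne'] at this
    exact mul_nonneg (Real.log_nonneg this) (by positivity)
  have hlim : Tendsto F atTop (𝓝 0) := by
    have t1 : Tendsto (fun t : ℝ => Real.log (t * b) / (1 * (t * b) + r * b)) atTop (𝓝 0) := by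
      have := (Real.tendsto_pow_log_div_mul_add_atTop 1 (r * b) 1 one_ne_zero)
      simp only [pow_one] at this
      exact this.comp (tendsto_id.atTop_mul_const hb)
    have t2 : Tendsto (fun t : ℝ => Real.log t - Real.log (t + r)) atTop (𝓝 0) := by
      have h := Real.tendsto_log_comp_add_sub_log r
      have := h.neg
      simpa using this
    have := (t1.const_mul (-(r * b))).add t2
    simp only [mul_zero, add_zero] at this
    refine this.congr' ?_
    filter_upwards [eventually_gt_atTop 0] with t ht
    simp only [hF]
    field_simp
  have hsub : Ioi b⁻¹ ⊆ Ioi 0 := Ioi_subset_Ioi ha.le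
  have hi := integrableOn_Ioi_deriv_of_nonneg' hderiv hnonneg hlim
  have hv := integral_Ioi_of_hasDerivAt_of_nonneg' hderiv hnonneg hlim
  have heq : EqOn (fun t : ℝ => Real.log (t * b) * (r / (t + r) ^ 2))
      (fun t : ℝ => posLog (t * b) * (r / (t + r) ^ 2)) (Ioi b⁻¹) := by
    intro t ht
    have ht0 : 0 < t := ha.trans ht
    have : 1 ≤ t * b := by
      have := mul_le_mul_of_nonneg_right (le_of_lt ht) hb.le
      rwa [inv_mul_cancel₀ hb.ne'] at this
    simp only
    rw [Real.posLog_eq_log (by rwa [abs_of_nonneg (by positivity)])]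
  have hzero : ∀ t ∈ Ioi (0 : ℝ) \ Ioi b⁻¹, posLog (t * b) * (r / (t + r) ^ 2) = 0 := by
    intro t ht
    have ht0 : 0 < t := ht.1
    have h2 : t ≤ b⁻¹ := not_lt.1 ht.2
    have : t * b ≤ 1 := by
      have := mul_le_mul_of_nonneg_right h2 hb.le
      rwa [inv_mul_cancel₀ hb.ne'] at this
    rw [(Real.posLog_eq_zero_iff _).2 (by rwa [abs_of_nonneg (by positivity)]), zero_mul]
  constructor
  · exact ((integrableOn_congr_fun heq measurableSet_Ioi).1 hi).of_forall_sdiff_eq_zero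
      measurableSet_Ioi hzero
  · rw [setIntegral_eq_of_subset_of_forall_sdiff_eq_zero measurableSet_Ioi hsub hzero,
      ← setIntegral_congr_fun measurableSet_Ioi heq, hv]
    simp only [hF]
    rw [inv_mul_cancel₀ hb.ne', Real.log_one, mul_zero, neg_zero, zero_add, zero_sub, neg_sub,
      ← Real.log_div (by positivity) (by positivity)]
    congr 1
    field_simp

theorem integrableOn_sum_posLog_mul_kernel {ι : Type*} (s : Finset ι) {b : ι → ℝ}
    (hb : ∀ i, 0 ≤ b i) {r : ℝ} (hr : 0 < r) :
    IntegrableOn (fun t : ℝ => (∑ i ∈ s, posLog (t * b i)) * (r / (t + r) ^ 2)) (Ioi 0) ∧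
      ∫ t in Ioi (0 : ℝ), (∑ i ∈ s, posLog (t * b i)) * (r / (t + r) ^ 2)
        = ∑ i ∈ s, Real.log (1 + r * b i) := by
  simp only [Finset.sum_mul]
  constructor
  · exact integrable_finsetSum s fun i _ => (integrableOn_posLog_mul_kernel (hb i) hr).1
  · rw [integral_finsetSum s fun i _ => (integrableOn_posLog_mul_kernel (hb i) hr).1]
    exact Finset.sum_congr rfl fun i _ => (integrableOn_posLog_mul_kernel (hb i) hr).2

/-- A bound `A + B t ^ p` for the counting function of a finite product of factors `1 + b i * t`
gives a bound for the logarithm of its value at `r`, with the sharp factor `gammaConst p`. -/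
theorem sum_log_one_add_le {ι : Type*} (s : Finset ι) {b : ι → ℝ} (hb : ∀ i, 0 ≤ b i) {p r A B : ℝ}
    (h0 : 0 ≤ p) (h1 : p < 1) (hr : 0 < r)
    (h : ∀ t, 0 < t → ∑ i ∈ s, posLog (t * b i) ≤ A + B * t ^ p) :
    ∑ i ∈ s, Real.log (1 + r * b i) ≤ A + B * (gammaConst p * r ^ p) := by
  obtain ⟨i1, v1⟩ := integrableOn_sum_posLog_mul_kernel s hb hr
  obtain ⟨i2, v2⟩ := integrableOn_rpow_mul_kernel h0 h1 hr
  obtain ⟨i3, v3⟩ := integrableOn_rpow_mul_kernel le_rfl one_pos hr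
  rw [gammaConst_zero, Real.rpow_zero, mul_one] at v3
  rw [← v1]
  calc _ ≤ ∫ t in Ioi (0 : ℝ), (A * (t ^ (0 : ℝ) * (r / (t + r) ^ 2))
        + B * (t ^ p * (r / (t + r) ^ 2))) := by
        refine setIntegral_mono_on i1 ((i3.const_mul A).add (i2.const_mul B)) measurableSet_Ioi ?_
        intro t ht
        have ht : 0 < t := ht
        have := mul_le_mul_of_nonneg_right (h t ht) (by positivity : 0 ≤ r / (t + r) ^ 2)
        rw [Real.rpow_zero]
        linarith
    _ = _ := by
        rw [integral_add (i3.const_mul A) (i2.const_mul B), integral_const_mul,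
          integral_const_mul, v2, v3]
        ring

/-! ### Jensen's formula and zeros of entire functions of order less than one -/

theorem Differentiable.meromorphic_of_complex {w : ℂ → ℂ} (hw : Differentiable ℂ w) :
    Meromorphic w := fun z => (hw.analyticAt z).meromorphicAt

theorem divisor_nonneg_of_differentiable {w : ℂ → ℂ} (hw : Differentiable ℂ w) (U : Set ℂ) :
    0 ≤ MeromorphicOn.divisor w U :=
  MeromorphicOn.AnalyticOnNhd.divisor_nonneg fun z _ => hw.analyticAt z

/-- Jensen's formula for entire functions. -/
theorem logCounting_zero_eq_circleAverage {w : ℂ → ℂ} (hw : Differentiable ℂ w) (h0 : w 0 = 1)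
    {r : ℝ} (hr : r ≠ 0) :
    ValueDistribution.logCounting w 0 r = circleAverage (fun z => Real.log ‖w z‖) 0 r := by
  have h := ValueDistribution.logCounting_zero_sub_logCounting_top_eq_circleAverage_sub_const
    hw.meromorphic_of_complex hr
  have htop : ValueDistribution.logCounting w ⊤ = 0 := by
    rw [ValueDistribution.logCounting_top,
      negPart_eq_zero.2 (divisor_nonneg_of_differentiable hw univ), map_zero]
  rw [htop, sub_zero, (hw.analyticAt 0).meromorphicTrailingCoeffAt_of_ne_zero
    (by rw [h0]; exact one_ne_zero), h0] at h
  simpa using h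

/-- The mean value inequality for `log ‖w‖`. -/
theorem circleAverage_log_norm_nonneg {w : ℂ → ℂ} (hw : Differentiable ℂ w) (h0 : w 0 = 1)
    {r : ℝ} (hr : 0 < r) : 0 ≤ circleAverage (fun z => Real.log ‖w z‖) 0 r := by
  rw [AnalyticOnNhd.circleAverage_log_norm hr.ne' (fun z _ => hw.analyticAt z)
    (by rw [h0]; exact one_ne_zero), h0]
  simp only [zero_sub, norm_neg, norm_one, Real.log_one, add_zero]
  refine finsum_nonneg fun u => ?_
  by_cases hu : u ∈ Metric.closedBall (0 : ℂ) |r|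
  · refine mul_nonneg (by exact_mod_cast divisor_nonneg_of_differentiable hw _ u) ?_
    rcases eq_or_ne u 0 with rfl | hu0
    · simp
    · refine Real.log_nonneg ?_
      rw [mem_closedBall_zero_iff, abs_of_pos hr] at hu
      rw [← div_eq_mul_inv, one_le_div (norm_pos_iff.2 hu0)]
      exact hu
  · rw [Function.locallyFinsuppWithin.apply_eq_zero_of_notMem _ hu]
    simp

theorem circleIntegrable_log_norm {w : ℂ → ℂ} (hw : Differentiable ℂ w) (r : ℝ) :
    CircleIntegrable (fun z => Real.log ‖w z‖) 0 r :=
  MeromorphicOn.circleIntegrable_log_norm fun z _ => hw.meromorphic_of_complex z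

theorem circleAverage_log_norm_mul {v w : ℂ → ℂ} (hv : Differentiable ℂ v)
    (hw : Differentiable ℂ w) (hv0 : v 0 ≠ 0) (hw0 : w 0 ≠ 0) {r : ℝ} (hr : r ≠ 0) :
    circleAverage (fun z => Real.log ‖v z * w z‖) 0 r
      = circleAverage (fun z => Real.log ‖v z‖) 0 r
        + circleAverage (fun z => Real.log ‖w z‖) 0 r := by
  rw [← Real.circleAverage_fun_add (circleIntegrable_log_norm hv r)
    (circleIntegrable_log_norm hw r)]
  -- `log (x * y) = log x + log y` fails at zeros, which form a negligible set on the circle.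
  refine Real.circleAverage_congr_codiscreteWithin ?_ hr
  have key : ∀ u : ℂ → ℂ, Differentiable ℂ u → u 0 ≠ 0 →
      ∀ᶠ z in codiscreteWithin (Metric.sphere (0 : ℂ) |r|), u z ≠ 0 := fun u hu hu0 =>
    Filter.codiscreteWithin_mono (subset_univ _)
      (AnalyticOnNhd.preimage_zero_mem_codiscrete (fun z _ => hu.analyticAt z) hu0)
  filter_upwards [key v hv hv0, key w hw hw0] with z h1 h2
  rw [norm_mul, Real.log_mul (norm_ne_zero_iff.2 h1) (norm_ne_zero_iff.2 h2)]

theorem circleAverage_log_norm_one_add_mul (b : ℂ) {r : ℝ} (hr : 0 < r) :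
    circleAverage (fun z => Real.log ‖1 + b * z‖) 0 r = posLog (r * ‖b‖) := by
  rcases eq_or_ne b 0 with rfl | hb
  · simp [Real.circleAverage_const]
  have hb' : 0 < ‖b‖ := norm_pos_iff.2 hb
  have h1 : (fun z => Real.log ‖1 + b * z‖) = fun z => Real.log ‖b * (z - (-b⁻¹))‖ := by
    ext z
    congr 2
    field_simp
    ring
  rw [h1, circleAverage_log_norm_mul (v := fun _ => b) (w := fun z => z - (-b⁻¹)) (by fun_prop)
    (by fun_prop) hb (by simpa using hb) hr.ne', Real.circleAverage_const,
    circleAverage_log_norm_sub_const_eq_log_radius_add_posLog hr.ne']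
  have h2 : r⁻¹ * ‖0 - -b⁻¹‖ = (r * ‖b‖)⁻¹ := by simp [mul_comm]
  rw [h2, ← add_assoc, ← Real.log_mul hb'.ne' hr.ne', mul_comm ‖b‖ r,
    ← Real.posLog_sub_posLog_inv]
  ring

theorem circleAverage_log_norm_prod {ι : Type*} (s : Finset ι) (b : ι → ℂ) {r : ℝ} (hr : 0 < r) :
    circleAverage (fun z => Real.log ‖∏ i ∈ s, (1 + b i * z)‖) 0 r
      = ∑ i ∈ s, posLog (r * ‖b i‖) := by
  classical
  induction s using Finset.induction_on with
  | empty => simp [Real.circleAverage_const]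
  | insert i s hi ih =>
    simp only [Finset.prod_insert hi, Finset.sum_insert hi]
    rw [circleAverage_log_norm_mul (v := fun z => 1 + b i * z)
      (w := fun z => ∏ i ∈ s, (1 + b i * z)) (by fun_prop)
      (Differentiable.fun_finsetProd fun i _ => by fun_prop) (by simp) (by simp) hr.ne', ih,
      circleAverage_log_norm_one_add_mul _ hr]

/-- Dividing finitely many zeros out of an entire function leaves a function whose logarithmic mean
is nonnegative, so the zeros divided out contribute at most the logarithmic mean of the
function. -/
theorem sum_posLog_le_circleAverage {ι : Type*} (s : Finset ι) (b : ι → ℂ) {g h : ℂ → ℂ}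
    (hh : Differentiable ℂ h) (h0 : h 0 = 1) (hg : ∀ z, g z = (∏ i ∈ s, (1 + b i * z)) * h z)
    {r : ℝ} (hr : 0 < r) :
    ∑ i ∈ s, posLog (r * ‖b i‖) ≤ circleAverage (fun z => Real.log ‖g z‖) 0 r := by
  simp only [hg]
  rw [circleAverage_log_norm_mul (v := fun z => ∏ i ∈ s, (1 + b i * z))
      (Differentiable.fun_finsetProd fun i _ => by fun_prop) hh (by simp) (by simp [h0]) hr.ne',
      circleAverage_log_norm_prod s b hr]
  linarith [circleAverage_log_norm_nonneg hh h0 hr]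

theorem exists_factor_of_zero {h : ℂ → ℂ} (hh : Differentiable ℂ h) (h0 : h 0 = 1) {a : ℂ}
    (ha : h a = 0) :
    ∃ k : ℂ → ℂ, Differentiable ℂ k ∧ k 0 = 1 ∧ ∀ z, h z = (1 + -a⁻¹ * z) * k z := by
  have ha0 : a ≠ 0 := by rintro rfl; simp [h0] at ha
  have key : ∀ z, h z = (1 + -a⁻¹ * z) * (-a * dslope h a z) := by
    intro z
    have := sub_smul_dslope h a z
    rw [ha, sub_zero, smul_eq_mul] at this
    rw [← this]
    field_simp
    ring
  refine ⟨fun z => -a * dslope h a z, ?_, ?_, key⟩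
  · have : Differentiable ℂ (dslope h a) := by
      have := (Complex.differentiableOn_dslope (f := h) (c := a) (s := univ) univ_mem).2
        hh.differentiableOn
      exact differentiableOn_univ.1 this
    exact this.const_mul _
  · have := key 0
    simpa [h0] using this.symm

/-- All the zeros of an entire function in a closed disc can be divided out: as long as a zero is
left, it can be split off, and the logarithmic mean over the circle of twice the radius bounds the
number of factors. -/
theorem exists_factorization {g : ℂ → ℂ} (hg : Differentiable ℂ g) (g0 : g 0 = 1) {R : ℝ}
    (hR : 0 < R) :
    ∃ (k : ℕ) (b : Fin k → ℂ) (h : ℂ → ℂ), Differentiable ℂ h ∧ h 0 = 1 ∧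
      (∀ z, g z = (∏ i, (1 + b i * z)) * h z) ∧ (∀ i, 1 ≤ R * ‖b i‖) ∧
      ∀ z ∈ Metric.closedBall (0 : ℂ) R, h z ≠ 0 := by
  by_contra! hcon
  -- If every quotient had a zero left, factorizations of any length would exist.
  have hall : ∀ k : ℕ, ∃ (b : Fin k → ℂ) (h : ℂ → ℂ), Differentiable ℂ h ∧ h 0 = 1 ∧
      (∀ z, g z = (∏ i, (1 + b i * z)) * h z) ∧ (∀ i, 1 ≤ R * ‖b i‖) := by
    intro k
    induction k with
    | zero => exact ⟨Fin.elim0, g, hg, g0, by simp, fun i => i.elim0⟩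
    | succ k ih =>
      obtain ⟨b, h, hh, h0, hprod, hb⟩ := ih
      obtain ⟨a, haR, ha⟩ := hcon k b h hh h0 hprod hb
      have ha0 : a ≠ 0 := by rintro rfl; simp [h0] at ha
      obtain ⟨l, hl, l0, hl'⟩ := exists_factor_of_zero hh h0 ha
      refine ⟨Fin.cons (-a⁻¹) b, l, hl, l0, fun z => ?_, fun i => ?_⟩
      · rw [hprod, hl', Fin.prod_univ_succ]
        simp only [Fin.cons_zero, Fin.cons_succ]
        ring
      · refine Fin.cases ?_ (fun i => ?_) i
        · rw [mem_closedBall_zero_iff] at haR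
          rw [Fin.cons_zero, norm_neg, norm_inv, ← div_eq_mul_inv, one_le_div (norm_pos_iff.2 ha0)]
          exact haR
        · simpa using hb i
  obtain ⟨k, hk⟩ := exists_nat_gt
    (circleAverage (fun z => Real.log ‖g z‖) 0 (2 * R) / Real.log 2)
  obtain ⟨b, h, hh, h0, hprod, hb⟩ := hall k
  have hlog : 0 < Real.log 2 := Real.log_pos one_lt_two
  have h1 := sum_posLog_le_circleAverage Finset.univ b hh h0 hprod (r := 2 * R) (by positivity)
  have h2 : ∑ _i : Fin k, Real.log 2 ≤ ∑ i, posLog (2 * R * ‖b i‖) := by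
    refine Finset.sum_le_sum fun i _ => ?_
    refine (Real.log_le_log two_pos ?_).trans (le_max_right _ _)
    nlinarith [hb i]
  rw [Finset.sum_const, Finset.card_univ, Fintype.card_fin, nsmul_eq_mul] at h2
  rw [div_lt_iff₀ hlog] at hk
  linarith

/-- Borel–Carathéodory for the logarithm of a zero-free function. -/
theorem norm_le_exp_of_ne_zero {h : ℂ → ℂ} (hh : Differentiable ℂ h) (h0 : h 0 = 1) {R M : ℝ}
    (hR : 0 < R) (hM : 0 < M) (hne : ∀ z ∈ Metric.ball (0 : ℂ) R, h z ≠ 0)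
    (hb : ∀ z ∈ Metric.ball (0 : ℂ) R, ‖h z‖ ≤ Real.exp M) {z : ℂ} (hz : ‖z‖ < R) :
    ‖h z‖ ≤ Real.exp (2 * M * ‖z‖ / (R - ‖z‖)) := by
  have hd : DifferentiableOn ℂ (fun z => deriv h z / h z) (Metric.ball 0 R) :=
    (hh.contDiff.differentiable_deriv_two).differentiableOn.div hh.differentiableOn hne
  obtain ⟨l, l0, hl⟩ := hd.isExactOn_ball.with_val_at 0 0
  have hexp : ∀ z ∈ Metric.ball (0 : ℂ) R, h z = Complex.exp (l z) := by
    have hz0 : (0 : ℂ) ∈ Metric.ball (0 : ℂ) R := Metric.mem_ball_self hR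
    have hder : ∀ z ∈ Metric.ball (0 : ℂ) R,
        HasDerivAt (fun z => h z * Complex.exp (-l z)) 0 z := by
      intro z hz
      have := (hh z).hasDerivAt.mul (hl z hz).neg.cexp
      convert! this using 1
      have := hne z hz
      field_simp
      ring
    intro z hz
    have hconst := (convex_ball (0 : ℂ) R).is_const_of_fderivWithin_eq_zero (𝕜 := ℂ)
      (f := fun z => h z * Complex.exp (-l z))
      (fun z hz => (hder z hz).differentiableAt.differentiableWithinAt)
      (fun z hz => by
        rw [fderivWithin_of_isOpen Metric.isOpen_ball hz]
        ext
        simpa using (hder z hz).deriv) hz hz0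
    simp only [h0, l0, neg_zero, Complex.exp_zero, mul_one] at hconst
    rw [Complex.exp_neg] at hconst
    field_simp at hconst
    exact hconst
  have hzR : z ∈ Metric.ball (0 : ℂ) R := mem_ball_zero_iff.2 hz
  have hBC := Complex.borelCaratheodory_zero hM
    (fun z hz => (hl z hz).differentiableAt.differentiableWithinAt) (fun z hz => by
      have := hb z hz
      rw [hexp z hz, Complex.norm_exp, Real.exp_le_exp] at this
      exact this) hR hzR l0
  rw [hexp z hzR, Complex.norm_exp]
  exact Real.exp_le_exp.2 ((Complex.re_le_norm _).trans hBC)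

/-- Let `g` be entire of order less than `1` with `g 0 = 1`. A bound `A + B t ^ p` for the counting
function of its zeros bounds `log ‖g‖`, with the sharp factor `gammaConst p`. -/
theorem norm_le_exp_of_logCounting_le {g : ℂ → ℂ} (hg : Differentiable ℂ g) (g0 : g 0 = 1)
    {p A B A' B' : ℝ} (hp0 : 0 < p) (hp1 : p < 1) (hA : 0 ≤ A) (hB : 0 ≤ B)
    (hA' : 0 < A') (hB' : 0 ≤ B')
    (hgrowth : ∀ z, ‖g z‖ ≤ Real.exp (A' + B' * ‖z‖ ^ p))
    (hN : ∀ t, 0 < t → ValueDistribution.logCounting g 0 t ≤ A + B * t ^ p) (z : ℂ) :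
    ‖g z‖ ≤ Real.exp (A + B * (gammaConst p * ‖z‖ ^ p)) := by
  have hC := gammaConst_pos hp0.le hp1
  rcases eq_or_ne z 0 with rfl | hz
  · rw [g0, norm_one, Real.one_le_exp_iff]
    positivity
  have hz : 0 < ‖z‖ := norm_pos_iff.2 hz
  set M : ℝ → ℝ := fun R => A' + B' * (2 * R) ^ p with hMdef
  have main : ∀ R, ‖z‖ < R → ‖g z‖ ≤ Real.exp (A + B * (gammaConst p * ‖z‖ ^ p)
      + 2 * M R * ‖z‖ / (R - ‖z‖)) := by
    intro R hRz
    have hR : 0 < R := hz.trans hRz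
    have hMpos : 0 < M R := by simp only [hMdef]; positivity
    obtain ⟨k, b, h, hh, h0, hprod, hb, hne⟩ := exists_factorization hg g0 hR
    -- On the circle of radius `2 * R` each factor has modulus at least `2 - 1 = 1`.
    have hfactor : ∀ w : ℂ, ‖w‖ = 2 * R → ‖h w‖ ≤ Real.exp (M R) := by
      intro w hw
      have h1 : 1 ≤ ‖∏ i, (1 + b i * w)‖ := by
        rw [norm_prod]
        rw [← Finset.prod_const_one (s := (Finset.univ : Finset (Fin k)))]
        refine Finset.prod_le_prod (fun _ _ => zero_le_one) fun i _ => ?_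
        have h2 := norm_sub_le (1 + b i * w) 1
        rw [add_sub_cancel_left, norm_mul, norm_one, hw] at h2
        nlinarith [hb i]
      calc ‖h w‖ ≤ ‖∏ i, (1 + b i * w)‖ * ‖h w‖ :=
            le_mul_of_one_le_left (norm_nonneg _) h1
        _ = ‖g w‖ := by rw [hprod, norm_mul]
        _ ≤ _ := by
            have := hgrowth w
            rwa [hw] at this
    have hball : ∀ w ∈ Metric.ball (0 : ℂ) R, ‖h w‖ ≤ Real.exp (M R) := by
      intro w hw
      refine Complex.norm_le_of_forall_mem_frontier_norm_le (U := Metric.ball (0 : ℂ) (2 * R))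
        Metric.isBounded_ball hh.diffContOnCl (fun w hw => ?_) (subset_closure ?_)
      · rw [frontier_ball _ (by positivity)] at hw
        exact hfactor w (mem_sphere_zero_iff_norm.1 hw)
      · exact Metric.ball_subset_ball (by linarith) hw
    have hh' := norm_le_exp_of_ne_zero hh h0 hR hMpos
      (fun w hw => hne w (Metric.ball_subset_closedBall hw)) hball hRz
    have hsum := sum_log_one_add_le Finset.univ (b := fun i => ‖b i‖) (fun i => norm_nonneg _)
      hp0.le hp1 hz (A := A) (B := B) fun t ht => by
        refine (sum_posLog_le_circleAverage Finset.univ b hh h0 hprod ht).trans ?_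
        rw [← logCounting_zero_eq_circleAverage hg g0 ht.ne']
        exact hN t ht
    have hP : ‖∏ i, (1 + b i * z)‖ ≤ Real.exp (A + B * (gammaConst p * ‖z‖ ^ p)) := by
      refine le_trans ?_ (Real.exp_le_exp.2 hsum)
      rw [Real.exp_sum, norm_prod]
      refine Finset.prod_le_prod (fun i _ => norm_nonneg _) fun i _ => ?_
      rw [Real.exp_log (by positivity)]
      refine (norm_add_le _ _).trans ?_
      rw [norm_one, norm_mul, mul_comm]
    rw [hprod, norm_mul, Real.exp_add]
    exact mul_le_mul hP hh' (norm_nonneg _) (Real.exp_nonneg _)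
  -- The contribution of the zero-free factor disappears as `R → ∞` because `p < 1`.
  have hlim : Tendsto (fun R => 2 * M R * ‖z‖ / (R - ‖z‖)) atTop (𝓝 0) := by
    have t1 : Tendsto (fun R : ℝ => (R - ‖z‖) / R) atTop (𝓝 1) := by
      have : Tendsto (fun R : ℝ => 1 - ‖z‖ / R) atTop (𝓝 (1 - 0)) :=
        tendsto_const_nhds.sub (tendsto_const_nhds.div_atTop tendsto_id)
      rw [sub_zero] at this
      refine this.congr' ?_
      filter_upwards [eventually_gt_atTop 0] with R hR
      field_simp
    have t2 : Tendsto (fun R : ℝ => R ^ (-(1 - p))) atTop (𝓝 0) :=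
      tendsto_rpow_neg_atTop (by linarith)
    have t3 : Tendsto (fun R : ℝ => A' / R) atTop (𝓝 0) :=
      tendsto_const_nhds.div_atTop tendsto_id
    have t4 := (((t3.add (t2.const_mul (B' * 2 ^ p))).const_mul (2 * ‖z‖)).div t1 one_ne_zero)
    simp only [mul_zero, add_zero, zero_div] at t4
    refine t4.congr' ?_
    filter_upwards [eventually_gt_atTop ‖z‖] with R hR
    have hR0 : 0 < R := hz.trans hR
    have hRz : R - ‖z‖ ≠ 0 := by linarith
    have e : R ^ (-(1 - p)) = R ^ p / R := by
      rw [neg_sub, Real.rpow_sub_one hR0.ne']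
    simp only [hMdef, Pi.div_apply, e]
    rw [Real.mul_rpow zero_le_two hR0.le]
    field_simp
  have hlim2 : Tendsto (fun R => Real.exp (A + B * (gammaConst p * ‖z‖ ^ p)
      + 2 * M R * ‖z‖ / (R - ‖z‖))) atTop (𝓝 (Real.exp (A + B * (gammaConst p * ‖z‖ ^ p)))) := by
    have := (tendsto_const_nhds (x := A + B * (gammaConst p * ‖z‖ ^ p))).add hlim
    rw [add_zero] at this
    exact (Real.continuous_exp.tendsto _).comp this
  exact ge_of_tendsto hlim2 ((eventually_gt_atTop ‖z‖).mono main)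

/-! ### The lower bound for entire maps -/

theorem norm_le_maxModulus {E F : Type*} [NormedAddCommGroup E] [ProperSpace E]
    [NormedAddCommGroup F] {f : E → F} (hf : Continuous f) (z : E) :
    ‖f z‖ ≤ maxModulus f ‖z‖ := by
  have hb : BddAbove (range fun w : Metric.sphere (0 : E) ‖z‖ => ‖f w‖) := by
    have := (isCompact_sphere (0 : E) ‖z‖).bddAbove_image (f := fun w => ‖f w‖)
      hf.norm.continuousOn
    rwa [image_eq_range] at this
  exact le_ciSup hb ⟨z, by simp⟩

theorem maxModulus_le {E F : Type*} [NormedAddCommGroup E] [NormedAddCommGroup F] {f : E → F}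
    {r C : ℝ} (hC : 0 ≤ C) (h : ∀ z, ‖z‖ = r → ‖f z‖ ≤ C) : maxModulus f r ≤ C :=
  Real.iSup_le (fun z => h z (by simp)) hC

section

variable {m n : ℕ} {f : EuclideanSpace ℂ (Fin m) → EuclideanSpace ℂ (Fin n)}

theorem differentiable_component (hf : Differentiable ℂ f) (j : Fin n) :
    Differentiable ℂ fun w => f w j :=
  (EuclideanSpace.proj (𝕜 := ℂ) j).differentiable.comp hf

theorem differentiable_compSlice (hf : Differentiable ℂ f) (j : Fin n)
    (ζ : EuclideanSpace ℂ (Fin m)) : Differentiable ℂ (compSlice f j ζ) :=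
  (differentiable_component hf j).comp (differentiable_id.smul_const ζ)

theorem compSlice_zero (h0 : ∀ j, f 0 j = 1) (j : Fin n) (ζ : EuclideanSpace ℂ (Fin m)) :
    compSlice f j ζ 0 = 1 := by
  simp [compSlice, h0]

theorem maxModulus_compSlice_le (hf : Differentiable ℂ f) (j : Fin n)
    {ζ : EuclideanSpace ℂ (Fin m)} (hζ : ‖ζ‖ = 1) (r : ℝ) :
    maxModulus (compSlice f j ζ) r ≤ maxModulus f r := by
  refine maxModulus_le (Real.iSup_nonneg fun _ => norm_nonneg _) fun z hz => ?_
  refine (PiLp.norm_apply_le (f (z • ζ)) j).trans ?_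
  have := norm_le_maxModulus hf.continuous (z • ζ)
  rwa [norm_smul, hζ, mul_one, hz] at this

theorem maxModulus_compSlice_le_modulusMax (hf : Differentiable ℂ f) (j : Fin n)
    {ζ : EuclideanSpace ℂ (Fin m)} (hζ : ‖ζ‖ = 1) (r : ℝ) :
    maxModulus (compSlice f j ζ) r ≤ modulusMax f r := by
  have hb : BddAbove (range fun ζ : Metric.sphere (0 : EuclideanSpace ℂ (Fin m)) 1 =>
      maxModulus (compSlice f j ζ) r) := by
    refine ⟨maxModulus f r, ?_⟩
    rintro _ ⟨ζ, rfl⟩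
    exact maxModulus_compSlice_le hf j (by simp) r
  exact (le_ciSup hb ⟨ζ, by simpa using hζ⟩).trans
    (le_ciSup (f := fun j : Fin n => ⨆ ζ : Metric.sphere (0 : EuclideanSpace ℂ (Fin m)) 1,
      maxModulus (compSlice f j ζ) r) (finite_range _).bddAbove j)

theorem norm_compSlice_le_modulusMax (hf : Differentiable ℂ f) (j : Fin n)
    {ζ : EuclideanSpace ℂ (Fin m)} (hζ : ‖ζ‖ = 1) (z : ℂ) :
    ‖compSlice f j ζ z‖ ≤ modulusMax f ‖z‖ :=
  (norm_le_maxModulus (differentiable_compSlice hf j ζ).continuous z).trans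
    (maxModulus_compSlice_le_modulusMax hf j hζ _)

theorem modulusMax_le {r C : ℝ} (hC : 0 ≤ C)
    (h : ∀ j w, ‖w‖ = r → ‖f w j‖ ≤ C) : modulusMax f r ≤ C := by
  refine Real.iSup_le (fun j => Real.iSup_le (fun ζ => maxModulus_le hC fun z hz => ?_) hC) hC
  have hζ : ‖(ζ : EuclideanSpace ℂ (Fin m))‖ = 1 := by simp
  exact h j _ (by rw [norm_smul, hζ, hz, mul_one])

theorem countingMax_le {r C : ℝ} (hC : 0 ≤ C)
    (h : ∀ j (ζ : EuclideanSpace ℂ (Fin m)), ‖ζ‖ = 1 →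
      ValueDistribution.logCounting (compSlice f j ζ) 0 r ≤ C) : countingMax f r ≤ C :=
  Real.iSup_le (fun j => Real.iSup_le (fun ζ => h j ζ (by simp)) hC) hC

/-- The maximum principle and Jensen's formula, for an entire function equal to `1` at the
origin. -/
theorem logCounting_le_log_of_norm_le {w : ℂ → ℂ} (hw : Differentiable ℂ w) (h0 : w 0 = 1)
    {r M : ℝ} (hr : 0 < r) (hM : ∀ z, ‖z‖ = r → ‖w z‖ ≤ M) :
    1 ≤ M ∧ ValueDistribution.logCounting w 0 r ≤ Real.log M := by
  have h1 : 1 ≤ M := by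
    have := Complex.norm_le_of_forall_mem_frontier_norm_le (U := Metric.ball (0 : ℂ) r)
      Metric.isBounded_ball hw.diffContOnCl (C := M) (fun z hz => hM z (by
        rw [frontier_ball _ hr.ne'] at hz
        exact mem_sphere_zero_iff_norm.1 hz)) (subset_closure (Metric.mem_ball_self hr))
    simpa [h0] using this
  refine ⟨h1, ?_⟩
  rw [logCounting_zero_eq_circleAverage hw h0 hr.ne']
  refine Real.circleAverage_mono_on_of_le_circle (circleIntegrable_log_norm hw r) fun z hz => ?_
  rw [mem_sphere_zero_iff_norm, abs_of_pos hr] at hz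
  -- At a zero of `w` the convention `log 0 = 0` is harmless because `1 ≤ M`.
  rcases (norm_nonneg (w z)).eq_or_lt with h | h
  · rw [← h, Real.log_zero]
    exact Real.log_nonneg h1
  · exact Real.log_le_log h (hM z hz)

theorem logCounting_compSlice_le (hf : Differentiable ℂ f) (h0 : ∀ j, f 0 j = 1) (j : Fin n)
    {ζ : EuclideanSpace ℂ (Fin m)} (hζ : ‖ζ‖ = 1) {r : ℝ} (hr : 0 < r) :
    1 ≤ modulusMax f r ∧
      ValueDistribution.logCounting (compSlice f j ζ) 0 r ≤ Real.log (modulusMax f r) :=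
  logCounting_le_log_of_norm_le (differentiable_compSlice hf j ζ) (compSlice_zero h0 j ζ) hr
    fun z hz => hz ▸ norm_compSlice_le_modulusMax hf j hζ z

theorem logCounting_compSlice_le_countingMax (hf : Differentiable ℂ f) (h0 : ∀ j, f 0 j = 1)
    (j : Fin n) {ζ : EuclideanSpace ℂ (Fin m)} (hζ : ‖ζ‖ = 1) {r : ℝ} (hr : 0 < r) :
    ValueDistribution.logCounting (compSlice f j ζ) 0 r ≤ countingMax f r := by
  have hb : BddAbove (range fun ζ : Metric.sphere (0 : EuclideanSpace ℂ (Fin m)) 1 =>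
      ValueDistribution.logCounting (compSlice f j ζ) 0 r) := by
    refine ⟨Real.log (modulusMax f r), ?_⟩
    rintro _ ⟨ζ, rfl⟩
    exact (logCounting_compSlice_le hf h0 j (by simp) hr).2
  exact (le_ciSup hb ⟨ζ, by simpa using hζ⟩).trans
    (le_ciSup (f := fun j : Fin n => ⨆ ζ : Metric.sphere (0 : EuclideanSpace ℂ (Fin m)) 1,
      ValueDistribution.logCounting (compSlice f j ζ) 0 r) (finite_range _).bddAbove j)

theorem exists_norm_eq_one (hm : 1 ≤ m) : ∃ ζ : EuclideanSpace ℂ (Fin m), ‖ζ‖ = 1 :=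
  ⟨EuclideanSpace.single ⟨0, hm⟩ 1, by simp⟩

theorem entireOrder_eq_zero_of_forall_eq (hm : 1 ≤ m) (h : ∀ w, f w = f 0) :
    entireOrder f = 0 := by
  obtain ⟨ζ, hζ⟩ := exists_norm_eq_one hm
  have hM : ∀ r : ℝ, 0 < r → maxModulus f r = ‖f 0‖ := by
    intro r hr
    have hf : f = fun _ => f 0 := funext h
    refine le_antisymm (maxModulus_le (norm_nonneg _) fun z _ => (h z ▸ le_rfl)) ?_
    have := norm_le_maxModulus (f := f) (by rw [hf]; exact continuous_const) ((r : ℂ) • ζ)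
    rwa [h, norm_smul, hζ, mul_one, Complex.norm_of_nonneg hr.le] at this
  have : Tendsto (fun r : ℝ => ((Real.log (Real.log (maxModulus f r)) / Real.log r : ℝ) : EReal))
      atTop (𝓝 ((0 : ℝ) : EReal)) := by
    refine (continuous_coe_real_ereal.tendsto 0).comp ?_
    have h1 : Tendsto (fun r : ℝ => Real.log (Real.log ‖f 0‖) / Real.log r) atTop (𝓝 0) :=
      tendsto_const_nhds.div_atTop Real.tendsto_log_atTop
    refine h1.congr' ?_
    filter_upwards [eventually_gt_atTop 0] with r hr
    rw [hM r hr]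
  rw [entireOrder, this.limsup_eq, EReal.coe_zero]

theorem eventually_maxModulus_le_exp {p : ℝ} (h : entireOrder f < (p : EReal)) :
    ∀ᶠ r in atTop, maxModulus f r ≤ Real.exp (r ^ p) := by
  filter_upwards [eventually_lt_of_limsup_lt h, eventually_gt_atTop 1] with r hr h1
  have hlog : 0 < Real.log r := Real.log_pos h1
  rw [EReal.coe_lt_coe_iff, div_lt_iff₀ hlog] at hr
  refine (Real.le_exp_log _).trans (Real.exp_le_exp.2 ?_)
  rcases le_or_gt (Real.log (maxModulus f r)) 0 with h2 | h2
  · exact h2.trans (Real.rpow_nonneg (by linarith) _)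
  · rw [← Real.log_rpow (by linarith)] at hr
    exact ((Real.log_lt_log_iff h2 (Real.rpow_pos_of_pos (by linarith) _)).1 hr).le

/-- If `log M(r; f) ≤ r ^ p` with `p < 1`, and the ratio of the counting function to the logarithm
of the maximum modulus stays below `1 / gammaConst p`, then `f` is bounded: the growth bound
reproduces itself with `r ^ p` multiplied by a factor less than `1`. -/
theorem exists_norm_le_of_countingMax_le (hf : Differentiable ℂ f)
    (h0 : ∀ j, f 0 j = 1) {p c : ℝ} (hp0 : 0 < p) (hp1 : p < 1) (hc0 : 0 ≤ c) (hc1 : c < 1)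
    (hq : c * gammaConst p < 1)
    (hM : ∀ᶠ r in atTop, maxModulus f r ≤ Real.exp (r ^ p))
    (hN : ∀ᶠ r in atTop, countingMax f r ≤ c * Real.log (modulusMax f r)) :
    ∃ K, ∀ w j, ‖f w j‖ ≤ K := by
  have hq0 : 0 ≤ c * gammaConst p := mul_nonneg hc0 (gammaConst_pos hp0.le hp1).le
  obtain ⟨t₀, ht₀⟩ := eventually_atTop.1 (hM.and hN)
  obtain ⟨C, hC⟩ := (isCompact_closedBall
    (0 : EuclideanSpace ℂ (Fin m)) t₀).exists_bound_of_continuousOn hf.continuous.continuousOn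
  set K : ℝ := Real.log (max C 1) with hK
  have hK0 : 0 ≤ K := Real.log_nonneg (le_max_right _ _)
  have hexpK : Real.exp K = max C 1 := Real.exp_log (by positivity)
  set K₁ : ℝ := K / (1 - c) with hK₁
  have hc1' : 0 < 1 - c := by linarith
  have hK₁0 : 0 ≤ K₁ := by positivity
  have hK₁eq : K + c * K₁ = K₁ := by rw [hK₁]; field_simp; ring
  have hsmall : ∀ w j, ‖w‖ ≤ t₀ → ‖f w j‖ ≤ Real.exp K := fun w j hw => by
    rw [hexpK]
    exact (PiLp.norm_apply_le (f w) j).trans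
      ((hC w (mem_closedBall_zero_iff.2 hw)).trans (le_max_left _ _))
  -- `K₁` is fixed by `x ↦ K + c * x`, so that each pass only shrinks the coefficient of `‖w‖ ^ p`.
  have iter : ∀ k : ℕ, ∀ w j, ‖f w j‖ ≤ Real.exp (K₁ + (c * gammaConst p) ^ k * ‖w‖ ^ p) := by
    intro k
    induction k with
    | zero =>
      intro w j
      have hp : 0 ≤ ‖w‖ ^ p := by positivity
      rw [pow_zero, one_mul]
      rcases le_total ‖w‖ t₀ with hw | hw
      · refine (hsmall w j hw).trans (Real.exp_le_exp.2 ?_)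
        nlinarith
      · refine ((PiLp.norm_apply_le (f w) j).trans (norm_le_maxModulus hf.continuous w)).trans ?_
        exact (ht₀ _ hw).1.trans (Real.exp_le_exp.2 (by linarith))
    | succ k ih =>
      intro w j
      have hqk : 0 ≤ (c * gammaConst p) ^ k := pow_nonneg hq0 k
      rcases eq_or_ne w 0 with rfl | hw
      · rw [h0, norm_one, Real.one_le_exp_iff]
        positivity
      have hw' : 0 < ‖w‖ := norm_pos_iff.2 hw
      set ζ : EuclideanSpace ℂ (Fin m) := ((‖w‖ : ℂ)⁻¹) • w with hζdef
      have hζ : ‖ζ‖ = 1 := by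
        rw [hζdef, norm_smul, norm_inv, Complex.norm_of_nonneg hw'.le, inv_mul_cancel₀ hw'.ne']
      have hslice := norm_le_exp_of_logCounting_le (differentiable_compSlice hf j ζ)
        (compSlice_zero h0 j ζ) hp0 hp1 hK₁0 (B := c * (c * gammaConst p) ^ k) (by positivity)
        (A' := K₁ + 1) (B' := (c * gammaConst p) ^ k) (by positivity) hqk
        (fun z => by
          refine (ih (z • ζ) j).trans (Real.exp_le_exp.2 ?_)
          rw [norm_smul, hζ, mul_one]
          linarith)
        (fun t ht => by
          have htp : 0 ≤ c * (c * gammaConst p) ^ k * t ^ p := by positivity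
          rcases le_total t t₀ with htt | htt
          · have := (logCounting_le_log_of_norm_le (differentiable_compSlice hf j ζ)
              (compSlice_zero h0 j ζ) ht (M := Real.exp K) fun z hz => hsmall (z • ζ) j (by
                rwa [norm_smul, hζ, mul_one, hz])).2
            rw [Real.log_exp] at this
            nlinarith
          · have h1 := logCounting_compSlice_le_countingMax hf h0 j hζ ht
            have h2 := (ht₀ t htt).2
            have h3 : Real.log (modulusMax f t) ≤ K₁ + (c * gammaConst p) ^ k * t ^ p := by
              have h4 := (logCounting_compSlice_le hf h0 j hζ ht).1
              rw [Real.log_le_iff_le_exp (by linarith)]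
              exact modulusMax_le (Real.exp_nonneg _) fun j w hw => hw ▸ ih w j
            nlinarith [mul_le_mul_of_nonneg_left h3 hc0])
        (‖w‖ : ℂ)
      have e : compSlice f j ζ (‖w‖ : ℂ) = f w j := by
        rw [compSlice, hζdef, smul_smul, mul_inv_cancel₀ (by exact_mod_cast hw'.ne'), one_smul]
      rw [e, Complex.norm_of_nonneg hw'.le] at hslice
      refine hslice.trans_eq ?_
      rw [pow_succ]
      ring_nf
  refine ⟨Real.exp K₁, fun w j => ?_⟩
  have hlim : Tendsto (fun k : ℕ => Real.exp (K₁ + (c * gammaConst p) ^ k * ‖w‖ ^ p)) atTop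
      (𝓝 (Real.exp (K₁ + 0 * ‖w‖ ^ p))) :=
    (Real.continuous_exp.tendsto _).comp
      (tendsto_const_nhds.add ((tendsto_pow_atTop_nhds_zero_of_lt_one hq0 hq).mul_const _))
  rw [zero_mul, add_zero] at hlim
  exact ge_of_tendsto' hlim fun k => iter k w j

theorem sin_div_le_growthRatio (hm : 1 ≤ m) (hn : 1 ≤ n) {ρ : ℝ} (hρ0 : 0 < ρ) (hρ1 : ρ < 1)
    (hf : Differentiable ℂ f) (h0 : ∀ j, f 0 j = 1) (hord : entireOrder f = (ρ : EReal)) :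
    ((Real.sin (Real.pi * ρ) / (Real.pi * ρ) : ℝ) : EReal) ≤ growthRatio f := by
  by_contra! hlt
  obtain ⟨c', hc'1, hc'2⟩ := EReal.lt_iff_exists_real_btwn.1 hlt
  rw [EReal.coe_lt_coe_iff] at hc'2
  have hπρ : 0 < Real.pi * ρ := mul_pos Real.pi_pos hρ0
  have hsin : 0 < Real.sin (Real.pi * ρ) :=
    Real.sin_pos_of_pos_of_lt_pi hπρ (by nlinarith [Real.pi_pos])
  have hC := gammaConst_pos hρ0.le hρ1
  have hσ : Real.sin (Real.pi * ρ) / (Real.pi * ρ) = (gammaConst ρ)⁻¹ := by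
    rw [gammaConst_eq hρ0, inv_div]
  have hσ1 : Real.sin (Real.pi * ρ) / (Real.pi * ρ) < 1 := by
    rw [div_lt_one hπρ]
    exact Real.sin_lt hπρ
  set c := max c' 0
  have hc0 : 0 ≤ c := le_max_right _ _
  have hcσ : c < (gammaConst ρ)⁻¹ := hσ ▸ max_lt hc'2 (div_pos hsin hπρ)
  have hc1 : c < 1 := by rw [← hσ] at hcσ; linarith
  have hq : c * gammaConst ρ < 1 := by
    rwa [← one_div, lt_div_iff₀ hC] at hcσ
  obtain ⟨p, hqp, hp1, hρp⟩ : ∃ p, c * gammaConst p < 1 ∧ p < 1 ∧ ρ < p := by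
    have e1 : ∀ᶠ p in 𝓝 ρ, c * gammaConst p < 1 :=
      ((continuousAt_gammaConst hρ0 hρ1).const_mul c).eventually_lt continuousAt_const hq
    have e2 : ∀ᶠ p in 𝓝 ρ, p < 1 := eventually_lt_nhds hρ1
    exact (((e1.and e2).filter_mono nhdsWithin_le_nhds).and
      (self_mem_nhdsWithin (s := Ioi ρ))).exists.imp fun p h => ⟨h.1.1, h.1.2, h.2⟩
  obtain ⟨ζ, hζ⟩ := exists_norm_eq_one hm
  have hN : ∀ᶠ r in atTop, countingMax f r ≤ c * Real.log (modulusMax f r) := by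
    filter_upwards [eventually_lt_of_limsup_lt hc'1, eventually_gt_atTop 0] with r hr hr0
    rw [EReal.coe_lt_coe_iff] at hr
    have hL := Real.log_nonneg (logCounting_compSlice_le hf h0 ⟨0, hn⟩ hζ hr0).1
    -- If `log M_max = 0`, the quotient is `0` by convention, but then `N_max ≤ 0` by Jensen.
    rcases hL.eq_or_lt with hL | hL
    · rw [← hL, mul_zero]
      exact countingMax_le le_rfl fun j ζ hζ =>
        (logCounting_compSlice_le hf h0 j hζ hr0).2.trans_eq hL.symm
    · exact ((div_le_iff₀ hL).1 (hr.le.trans (le_max_left _ _)))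
  obtain ⟨K, hK⟩ := exists_norm_le_of_countingMax_le hf h0 (hρ0.trans hρp) hp1 hc0 hc1 hqp
    (eventually_maxModulus_le_exp (by rw [hord]; exact_mod_cast hρp)) hN
  have hconst : ∀ w, f w = f 0 := fun w => by
    ext j
    refine (differentiable_component hf j).apply_eq_apply_of_bounded ?_ w 0
    refine isBounded_iff_forall_norm_le.2 ⟨K, ?_⟩
    rintro _ ⟨w, rfl⟩
    exact hK w j
  rw [entireOrder_eq_zero_of_forall_eq hm hconst] at hord
  have : (0 : ℝ) = ρ := by exact_mod_cast hord
  linarith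

end

/-! ### A canonical product with negative zeros -/

/-- The counting function of an infinite product of factors `1 + b k * z` is at most the sum of
those of its factors. The zeros are not located: Jensen's formula is applied to a partial product,
and the remaining factors change the logarithm of the modulus by at most a small `δ`. -/
theorem logCounting_le_of_tendsto_prod {b : ℕ → ℂ} (hb : Summable fun k => ‖b k‖) {w : ℂ → ℂ}
    (hw : Differentiable ℂ w)
    (hlim : ∀ z, Tendsto (fun N => ∏ k ∈ Finset.range N, (1 + b k * z)) atTop (𝓝 (w z)))
    {r Λ : ℝ} (hr : 0 < r) (hΛ : ∀ N, ∑ k ∈ Finset.range N, posLog (r * ‖b k‖) ≤ Λ) :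
    ValueDistribution.logCounting w 0 r ≤ Λ := by
  have hw0 : w 0 = 1 := tendsto_nhds_unique (hlim 0) (by simp)
  rw [logCounting_zero_eq_circleAverage hw hw0 hr.ne']
  refine le_of_forall_pos_le_add fun ε hε => ?_
  set δ : ℝ := min ε (1 / 2) with hδ
  have hδ0 : 0 < δ := lt_min hε (by norm_num)
  -- The tail of the product differs from `1` by at most `exp δ - 1 < 1` on the circle, so it has
  -- no zeros there.
  have hexp : Real.exp δ < 2 := by
    have h1 : δ < Real.log 2 := (min_le_right _ _).trans_lt (by linarith [Real.log_two_gt_d9])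
    rwa [← Real.lt_log_iff_exp_lt two_pos]
  obtain ⟨N, hN⟩ : ∃ N, ∀ M, ∑ k ∈ Finset.range M, ‖b (N + k)‖ * r ≤ δ := by
    have h1 := tendsto_sum_nat_add fun k => ‖b k‖
    obtain ⟨N, hN⟩ := (h1.eventually_lt_const (show (0 : ℝ) < δ / r by positivity)).exists
    refine ⟨N, fun M => ?_⟩
    rw [← Finset.sum_mul, ← le_div_iff₀ hr]
    have hs : Summable fun k => ‖b (k + N)‖ := (summable_nat_add_iff N).2 hb
    refine le_trans ?_ hN.le
    simp only [add_comm N]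
    exact hs.sum_le_tsum _ fun _ _ => norm_nonneg _
  set P : ℂ → ℂ := fun z => ∏ k ∈ Finset.range N, (1 + b k * z) with hP
  have htail : ∀ z, ‖z‖ = r → ∀ M,
      ‖∏ k ∈ Finset.range M, (1 + b (N + k) * z) - 1‖ ≤ Real.exp δ - 1 := by
    intro z hz M
    refine (Finset.norm_prod_one_add_sub_one_le _ _).trans ?_
    have := hN M
    simp only [norm_mul, hz]
    gcongr
  have hsplit : ∀ z M, ∏ k ∈ Finset.range (N + M), (1 + b k * z)
      = P z * ∏ k ∈ Finset.range M, (1 + b (N + k) * z) := fun z M =>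
    Finset.prod_range_add _ _ _
  have hlim' : ∀ z, Tendsto (fun M => ‖P z * ∏ k ∈ Finset.range M, (1 + b (N + k) * z)‖) atTop
      (𝓝 ‖w z‖) := by
    intro z
    have := ((hlim z).comp (tendsto_add_atTop_nat N)).norm
    refine this.congr fun M => ?_
    rw [Function.comp_apply, add_comm, hsplit]
  have hPd : Differentiable ℂ P := Differentiable.fun_finsetProd fun i _ => by fun_prop
  have hpt : ∀ z ∈ Metric.sphere (0 : ℂ) |r|, Real.log ‖w z‖ ≤ Real.log ‖P z‖ + δ := by
    intro z hz
    rw [mem_sphere_zero_iff_norm, abs_of_pos hr] at hz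
    have hup : ‖w z‖ ≤ ‖P z‖ * Real.exp δ := by
      refine le_of_tendsto' (hlim' z) fun M => ?_
      rw [norm_mul]
      have h1 := htail z hz M
      have h2 := norm_le_norm_sub_add (∏ k ∈ Finset.range M, (1 + b (N + k) * z)) 1
      rw [norm_one] at h2
      gcongr
      linarith
    have hlow : ‖P z‖ * (2 - Real.exp δ) ≤ ‖w z‖ := by
      refine ge_of_tendsto' (hlim' z) fun M => ?_
      rw [norm_mul]
      have h1 := htail z hz M
      have h2 := norm_sub_norm_le (1 : ℂ) (∏ k ∈ Finset.range M, (1 + b (N + k) * z))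
      rw [norm_one, norm_sub_rev] at h2
      gcongr
      linarith
    rcases (norm_nonneg (P z)).eq_or_lt with h | h
    · rw [← h, zero_mul] at hup
      rw [← h, le_antisymm hup (norm_nonneg _), Real.log_zero]
      linarith
    · have hwpos : 0 < ‖w z‖ := lt_of_lt_of_le (mul_pos h (by linarith)) hlow
      refine (Real.log_le_log hwpos hup).trans_eq ?_
      rw [Real.log_mul h.ne' (Real.exp_pos _).ne', Real.log_exp]
  have hPi := circleIntegrable_log_norm hPd r
  have := Real.circleAverage_mono (circleIntegrable_log_norm hw r)
    (hPi.add (circleIntegrable_const δ 0 r)) hpt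
  refine this.trans ?_
  have h2 := Real.circleAverage_fun_add hPi (circleIntegrable_const δ 0 r)
  rw [Real.circleAverage_const, circleAverage_log_norm_prod _ _ hr] at h2
  have h3 := hΛ N
  have h4 : δ ≤ ε := min_le_left _ _
  calc _ = _ := h2
    _ ≤ _ := by linarith

/-- The nonzero terms are those with `k + 1 < X`, so the sum is `log (X ^ N / N!)` for some `N`, and
`X ^ N / N! ≤ exp X`. -/
theorem sum_posLog_div_le {X : ℝ} (hX : 0 < X) (K : ℕ) :
    ∑ k ∈ Finset.range K, posLog (X / (k + 1)) ≤ X := by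
  have key : ∃ N : ℕ, ∑ k ∈ Finset.range K, posLog (X / (k + 1))
      = Real.log (X ^ N / N.factorial) ∧ (N = K ∨ X ≤ K + 1) := by
    induction K with
    | zero => exact ⟨0, by simp, Or.inl rfl⟩
    | succ K ih =>
      obtain ⟨N, hN, h⟩ := ih
      rw [Finset.sum_range_succ, hN]
      have hK : (0 : ℝ) < K + 1 := by positivity
      rcases le_or_gt X (K + 1) with h' | h'
      · refine ⟨N, ?_, Or.inr (by push_cast; linarith)⟩
        rw [(Real.posLog_eq_zero_iff _).2, add_zero]
        rw [abs_of_nonneg (by positivity), div_le_one hK]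
        exact h'
      · obtain rfl : N = K := h.resolve_right (not_le.2 h')
        refine ⟨N + 1, ?_, Or.inl rfl⟩
        rw [Real.posLog_eq_log, ← Real.log_mul (by positivity) (by positivity),
          Nat.factorial_succ, pow_succ]
        · push_cast
          congr 1
          field_simp
        · rw [abs_of_nonneg (by positivity), one_le_div hK]
          exact h'.le
  obtain ⟨N, hN, -⟩ := key
  rw [hN, Real.log_le_iff_le_exp (by positivity)]
  exact Real.pow_div_factorial_le_exp X hX.le N

/-- A weak form of Stirling's formula. -/
theorem log_factorial_le (N : ℕ) (hN : 1 ≤ N) :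
    Real.log N.factorial ≤ N * Real.log N - N + 1 + Real.log N := by
  induction N, hN using Nat.le_induction with
  | base => simp
  | succ N hN ih =>
    have hN0 : (0 : ℝ) < N := by exact_mod_cast hN
    have h1 := Real.one_sub_inv_le_log_of_pos (show (0 : ℝ) < (N + 1) / N by positivity)
    rw [Real.log_div (by positivity) hN0.ne'] at h1
    have h2 : (N + 1 : ℝ) * (1 - ((N + 1 : ℝ) / N)⁻¹) = 1 := by field_simp; ring
    have h3 := mul_le_mul_of_nonneg_left h1 (show (0 : ℝ) ≤ N + 1 by positivity)
    rw [Nat.factorial_succ]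
    push_cast
    rw [Real.log_mul (by positivity) (by positivity)]
    nlinarith

theorem le_sum_posLog_div {X : ℝ} (hX : 0 < X) {K : ℕ} (hK : X ≤ K) :
    X - 2 - 2 * X ^ (1 / 2 : ℝ) ≤ ∑ k ∈ Finset.range K, posLog (X / (k + 1)) := by
  have hsum0 : 0 ≤ ∑ k ∈ Finset.range K, posLog (X / (k + 1)) :=
    Finset.sum_nonneg fun _ _ => Real.posLog_nonneg
  have hs : 0 < X ^ (1 / 2 : ℝ) := Real.rpow_pos_of_pos hX _
  rcases lt_or_ge X 1 with h1 | h1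
  · linarith
  set N := ⌊X⌋₊ with hNdef
  have hN1 : 1 ≤ N := Nat.one_le_floor_iff X |>.2 h1
  have hNX : (N : ℝ) ≤ X := Nat.floor_le hX.le
  have hXN : X < N + 1 := Nat.lt_floor_add_one X
  have hN0 : (0 : ℝ) < N := by exact_mod_cast hN1
  have hNK : N ≤ K := by exact_mod_cast hNX.trans hK
  have e : ∀ N : ℕ, ∑ k ∈ Finset.range N, Real.log (X / (k + 1))
      = N * Real.log X - Real.log N.factorial := by
    intro N
    induction N with
    | zero => simp
    | succ N ih =>
      rw [Finset.sum_range_succ, ih, Nat.factorial_succ]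
      push_cast
      rw [Real.log_div hX.ne' (by positivity), Real.log_mul (by positivity) (by positivity)]
      ring
  have h2 : ∑ k ∈ Finset.range N, Real.log (X / (k + 1))
      ≤ ∑ k ∈ Finset.range K, posLog (X / (k + 1)) :=
    (Finset.sum_le_sum fun _ _ => le_max_right _ _).trans
      (Finset.sum_le_sum_of_subset_of_nonneg (Finset.range_mono hNK)
        fun _ _ _ => Real.posLog_nonneg)
  rw [e] at h2
  have h3 := log_factorial_le N hN1
  have h4 := Real.log_le_log hN0 hNX
  have h5 : Real.log X ≤ 2 * X ^ (1 / 2 : ℝ) := by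
    have := Real.log_le_rpow_div hX.le (show (0 : ℝ) < 1 / 2 by norm_num)
    linarith
  nlinarith

/-- The reciprocal moduli `(k + 1) ^ (-1 / ρ)` of the zeros `-(k + 1) ^ (1 / ρ)`, chosen so that
`⌊t ^ ρ⌋` of the zeros lie in the disc of radius `t`. -/
noncomputable def invZero (ρ : ℝ) (k : ℕ) : ℝ := ((k : ℝ) + 1) ^ (-(1 / ρ))

/-- The canonical product of genus zero with the negative zeros `-(k + 1) ^ (1 / ρ)`. -/
noncomputable def negZeroProduct (ρ : ℝ) (z : ℂ) : ℂ := ∏' k, (1 + (invZero ρ k : ℂ) * z)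

section

variable {ρ : ℝ}

theorem invZero_pos (ρ : ℝ) (k : ℕ) : 0 < invZero ρ k := Real.rpow_pos_of_pos (by positivity) _

theorem summable_invZero (hρ0 : 0 < ρ) (hρ1 : ρ < 1) : Summable (invZero ρ) := by
  have h : -(1 / ρ) < -1 := by
    rw [neg_lt_neg_iff, lt_div_iff₀ hρ0]
    linarith
  have := (summable_nat_add_iff 1).2 (Real.summable_nat_rpow.2 h)
  refine this.congr fun k => ?_
  simp [invZero]

theorem summable_norm_invZero_mul (hρ0 : 0 < ρ) (hρ1 : ρ < 1) (c : ℂ) :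
    Summable fun k => ‖(invZero ρ k : ℂ) * c‖ := by
  simp only [norm_mul, Complex.norm_of_nonneg (invZero_pos ρ _).le]
  exact (summable_invZero hρ0 hρ1).mul_right _

theorem tendsto_negZeroProduct (hρ0 : 0 < ρ) (hρ1 : ρ < 1) (z : ℂ) :
    Tendsto (fun N => ∏ k ∈ Finset.range N, (1 + (invZero ρ k : ℂ) * z)) atTop
      (𝓝 (negZeroProduct ρ z)) :=
  (multipliable_one_add_of_summable
    (summable_norm_invZero_mul hρ0 hρ1 z)).hasProd.tendsto_prod_nat

theorem negZeroProduct_zero (ρ : ℝ) : negZeroProduct ρ 0 = 1 := by simp [negZeroProduct]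

theorem differentiable_negZeroProduct (hρ0 : 0 < ρ) (hρ1 : ρ < 1) :
    Differentiable ℂ (negZeroProduct ρ) := by
  intro z
  have hR : z ∈ Metric.ball (0 : ℂ) (‖z‖ + 1) := by simp
  have hprod := Summable.hasProdLocallyUniformlyOn_nat_one_add
    (f := fun k (z : ℂ) => (invZero ρ k : ℂ) * z)
    (Metric.isOpen_ball (x := (0 : ℂ)) (ε := ‖z‖ + 1))
    ((summable_invZero hρ0 hρ1).mul_right (‖z‖ + 1))
    (Eventually.of_forall fun k x hx => by
      rw [norm_mul, Complex.norm_of_nonneg (invZero_pos ρ k).le]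
      exact mul_le_mul_of_nonneg_left (mem_ball_zero_iff.1 hx).le (invZero_pos ρ k).le)
    (fun k => by fun_prop)
  have hd := TendstoLocallyUniformlyOn.differentiableOn
    (hasProdLocallyUniformlyOn_iff_tendstoLocallyUniformlyOn.1 hprod)
    (Eventually.of_forall fun s => DifferentiableOn.fun_finsetProd fun i _ => by fun_prop)
    Metric.isOpen_ball
  exact (hd z hR).differentiableAt (Metric.isOpen_ball.mem_nhds hR)

theorem posLog_mul_invZero (hρ0 : 0 < ρ) {t : ℝ} (ht : 0 < t) (k : ℕ) :
    posLog (t * invZero ρ k) = ρ⁻¹ * posLog (t ^ ρ / (k + 1)) := by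
  have hk : (0 : ℝ) < k + 1 := by positivity
  have h : Real.log (t * invZero ρ k) = ρ⁻¹ * Real.log (t ^ ρ / (k + 1)) := by
    rw [Real.log_mul ht.ne' (invZero_pos ρ k).ne', invZero, Real.log_rpow hk,
      Real.log_div (Real.rpow_pos_of_pos ht _).ne' hk.ne', Real.log_rpow ht]
    field_simp
    ring
  rw [Real.posLog_apply, Real.posLog_apply, h, mul_max_of_nonneg _ _ (inv_nonneg.2 hρ0.le),
    mul_zero]

theorem sum_posLog_invZero_le (hρ0 : 0 < ρ) {t : ℝ} (ht : 0 < t) (K : ℕ) :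
    ∑ k ∈ Finset.range K, posLog (t * invZero ρ k) ≤ ρ⁻¹ * t ^ ρ := by
  simp only [posLog_mul_invZero hρ0 ht, ← Finset.mul_sum]
  exact mul_le_mul_of_nonneg_left (sum_posLog_div_le (Real.rpow_pos_of_pos ht _) K)
    (inv_nonneg.2 hρ0.le)

theorem le_sum_posLog_invZero (hρ0 : 0 < ρ) {t : ℝ} (ht : 0 < t) {K : ℕ} (hK : t ^ ρ ≤ K) :
    ρ⁻¹ * (t ^ ρ - 2 - 2 * t ^ (ρ / 2)) ≤ ∑ k ∈ Finset.range K, posLog (t * invZero ρ k) := by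
  simp only [posLog_mul_invZero hρ0 ht, ← Finset.mul_sum]
  have := le_sum_posLog_div (Real.rpow_pos_of_pos ht ρ) hK
  rw [← Real.rpow_mul ht.le, mul_one_div] at this
  exact mul_le_mul_of_nonneg_left this (inv_nonneg.2 hρ0.le)

theorem norm_negZeroProduct_le (hρ0 : 0 < ρ) (hρ1 : ρ < 1) (z : ℂ) :
    ‖negZeroProduct ρ z‖ ≤ Real.exp (ρ⁻¹ * (gammaConst ρ * ‖z‖ ^ ρ)) := by
  have hC := gammaConst_pos hρ0.le hρ1
  rcases eq_or_ne z 0 with rfl | hz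
  · rw [negZeroProduct_zero, norm_one, Real.one_le_exp_iff]
    positivity
  refine le_of_tendsto' (tendsto_negZeroProduct hρ0 hρ1 z).norm fun N => ?_
  have hsum := sum_log_one_add_le (Finset.range N) (fun k => (invZero_pos ρ k).le) hρ0.le hρ1
    (norm_pos_iff.2 hz) (A := 0) (B := ρ⁻¹) fun t ht => by
      rw [zero_add]
      exact sum_posLog_invZero_le hρ0 ht N
  rw [zero_add] at hsum
  refine le_trans ?_ (Real.exp_le_exp.2 hsum)
  rw [Real.exp_sum, norm_prod]
  refine Finset.prod_le_prod (fun i _ => norm_nonneg _) fun k _ => ?_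
  have hk := invZero_pos ρ k
  rw [Real.exp_log (by positivity)]
  refine (norm_add_le _ _).trans ?_
  rw [norm_one, norm_mul, Complex.norm_of_nonneg hk.le, mul_comm]

theorem sum_log_le_log_norm_negZeroProduct (hρ0 : 0 < ρ) (hρ1 : ρ < 1) {r : ℝ} (hr : 0 < r)
    (K : ℕ) :
    ∑ k ∈ Finset.range K, Real.log (1 + r * invZero ρ k) ≤ Real.log ‖negZeroProduct ρ r‖ := by
  have hpos : ∀ k, 0 < r * invZero ρ k := fun k => mul_pos hr (invZero_pos ρ k)
  have h : Real.exp (∑ k ∈ Finset.range K, Real.log (1 + r * invZero ρ k))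
      ≤ ‖negZeroProduct ρ r‖ := by
    refine ge_of_tendsto (tendsto_negZeroProduct hρ0 hρ1 r).norm ?_
    filter_upwards [eventually_ge_atTop K] with N hN
    have e : ‖∏ k ∈ Finset.range N, (1 + (invZero ρ k : ℂ) * r)‖
        = Real.exp (∑ k ∈ Finset.range N, Real.log (1 + r * invZero ρ k)) := by
      rw [Real.exp_sum, norm_prod]
      refine Finset.prod_congr rfl fun k _ => ?_
      have := hpos k
      rw [Real.exp_log (by linarith), ← Complex.ofReal_mul, ← Complex.ofReal_one,
        ← Complex.ofReal_add, Complex.norm_of_nonneg (by nlinarith), mul_comm]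
    rw [e]
    exact Real.exp_le_exp.2 (Finset.sum_le_sum_of_subset_of_nonneg (Finset.range_mono hN)
      fun k _ _ => Real.log_nonneg (by linarith [hpos k]))
  rw [← Real.log_exp (∑ k ∈ Finset.range K, Real.log (1 + r * invZero ρ k))]
  exact Real.log_le_log (Real.exp_pos _) h

/-- The lower bound for `log ‖negZeroProduct ρ r‖`, whose main term agrees with that of the upper
bound in `norm_negZeroProduct_le`. -/
noncomputable def growthMinorant (ρ r : ℝ) : ℝ :=
  ρ⁻¹ * (gammaConst ρ * r ^ ρ - 2 - 2 * (gammaConst (ρ / 2) * r ^ (ρ / 2)))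

theorem growthMinorant_le (hρ0 : 0 < ρ) (hρ1 : ρ < 1) {r : ℝ} (hr : 0 < r) :
    growthMinorant ρ r ≤ Real.log ‖negZeroProduct ρ r‖ := by
  obtain ⟨i1, v1⟩ := integrableOn_rpow_mul_kernel hρ0.le hρ1 hr
  obtain ⟨i2, v2⟩ := integrableOn_rpow_mul_kernel (p := ρ / 2) (by linarith) (by linarith) hr
  obtain ⟨i3, v3⟩ := integrableOn_rpow_mul_kernel le_rfl one_pos hr
  rw [gammaConst_zero, Real.rpow_zero, mul_one] at v3
  set H : ℝ → ℝ := fun t => ρ⁻¹ * (t ^ ρ * (r / (t + r) ^ 2)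
    - 2 * (t ^ (0 : ℝ) * (r / (t + r) ^ 2)) - 2 * (t ^ (ρ / 2) * (r / (t + r) ^ 2))) with hH
  have hHi : IntegrableOn H (Ioi 0) :=
    ((i1.sub (i3.const_mul 2)).sub (i2.const_mul 2)).const_mul _
  have i13 : IntegrableOn (fun t : ℝ => t ^ ρ * (r / (t + r) ^ 2)
      - 2 * (t ^ (0 : ℝ) * (r / (t + r) ^ 2))) (Ioi 0) := i1.sub (i3.const_mul 2)
  have hHv : ∫ t in Ioi (0 : ℝ), H t = growthMinorant ρ r := by
    simp only [hH]
    rw [integral_const_mul, integral_sub i13 (i2.const_mul 2),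
      integral_sub i1 (i3.const_mul 2), integral_const_mul, integral_const_mul, v1, v2, v3,
      growthMinorant, mul_one]
  have hlim := intervalIntegral_tendsto_integral_Ioi 0 hHi tendsto_id
  rw [hHv] at hlim
  -- On `(0, T]` the partial product with `K ≥ T ^ ρ` factors has all the relevant zeros.
  refine le_of_tendsto hlim ?_
  filter_upwards [eventually_gt_atTop 0] with T hT
  obtain ⟨K, hK⟩ := exists_nat_ge (T ^ ρ)
  obtain ⟨i4, v4⟩ := integrableOn_sum_posLog_mul_kernel (Finset.range K)
    (fun k => (invZero_pos ρ k).le) hr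
  refine le_trans ?_ (sum_log_le_log_norm_negZeroProduct hρ0 hρ1 hr K)
  rw [← v4, id, intervalIntegral.integral_of_le hT.le]
  refine (setIntegral_mono_on (hHi.mono_set Ioc_subset_Ioi_self)
    (i4.mono_set Ioc_subset_Ioi_self) measurableSet_Ioc fun t ht => ?_).trans
    (setIntegral_mono_set i4 ?_ Ioc_subset_Ioi_self.eventuallyLE)
  · have htK : t ^ ρ ≤ K := (Real.rpow_le_rpow ht.1.le ht.2 hρ0.le).trans hK
    have := mul_le_mul_of_nonneg_right (le_sum_posLog_invZero hρ0 ht.1 htK)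
      (by positivity : 0 ≤ r / (t + r) ^ 2)
    simp only [hH, Real.rpow_zero]
    linarith
  · filter_upwards with t
    exact mul_nonneg (Finset.sum_nonneg fun _ _ => Real.posLog_nonneg) (by positivity)

theorem tendsto_growthMinorant_div (hρ0 : 0 < ρ) :
    Tendsto (fun r => growthMinorant ρ r / r ^ ρ) atTop (𝓝 (ρ⁻¹ * gammaConst ρ)) := by
  have t1 : Tendsto (fun r : ℝ => r ^ (-ρ)) atTop (𝓝 0) := tendsto_rpow_neg_atTop hρ0
  have t2 : Tendsto (fun r : ℝ => r ^ (-(ρ / 2))) atTop (𝓝 0) :=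
    tendsto_rpow_neg_atTop (by linarith)
  have := (((tendsto_const_nhds (x := gammaConst ρ)).sub (t1.const_mul 2)).sub
    (t2.const_mul (2 * gammaConst (ρ / 2)))).const_mul ρ⁻¹
  simp only [mul_zero, sub_zero] at this
  refine this.congr' ?_
  filter_upwards [eventually_gt_atTop 0] with r hr
  have h1 : r ^ ρ ≠ 0 := (Real.rpow_pos_of_pos hr _).ne'
  have h2 : r ^ (-(ρ / 2)) = r ^ (ρ / 2) / r ^ ρ := by
    rw [← Real.rpow_sub hr]
    congr 1
    ring
  rw [h2, Real.rpow_neg hr.le, growthMinorant]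
  field_simp

theorem logCounting_negZeroProduct_le (hρ0 : 0 < ρ) (hρ1 : ρ < 1) {c : ℂ} (hc : ‖c‖ ≤ 1) {r : ℝ}
    (hr : 0 < r) :
    ValueDistribution.logCounting (fun z => negZeroProduct ρ (z * c)) 0 r ≤ ρ⁻¹ * r ^ ρ := by
  refine logCounting_le_of_tendsto_prod (summable_norm_invZero_mul hρ0 hρ1 c)
    ((differentiable_negZeroProduct hρ0 hρ1).comp (differentiable_id.mul_const c))
    (fun z => (tendsto_negZeroProduct hρ0 hρ1 (z * c)).congr fun N =>
      Finset.prod_congr rfl fun k _ => by ring) hr fun N => ?_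
  refine le_trans (Finset.sum_le_sum fun k _ => ?_) (sum_posLog_invZero_le hρ0 hr N)
  have hk := invZero_pos ρ k
  refine Real.posLog_le_posLog (by positivity) ?_
  rw [norm_mul, Complex.norm_of_nonneg hk.le]
  gcongr
  nlinarith

end

/-! ### The extremal map -/

/-- The map `ℂ^m → ℂ^n` all of whose components are `negZeroProduct ρ` of the first coordinate. -/
noncomputable def sharpMap {m : ℕ} (hm : 1 ≤ m) (n : ℕ) (ρ : ℝ) (w : EuclideanSpace ℂ (Fin m)) :
    EuclideanSpace ℂ (Fin n) :=
  WithLp.toLp 2 fun _ => negZeroProduct ρ (w ⟨0, hm⟩)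

section

variable {m n : ℕ} {ρ : ℝ}

theorem differentiable_sharpMap (hm : 1 ≤ m) (hρ0 : 0 < ρ) (hρ1 : ρ < 1) :
    Differentiable ℂ (sharpMap hm n ρ) := by
  refine differentiable_euclidean.2 fun j => ?_
  exact (differentiable_negZeroProduct hρ0 hρ1).comp (differentiable_component differentiable_id _)

theorem sharpMap_zero (hm : 1 ≤ m) (j : Fin n) : sharpMap hm n ρ 0 j = 1 := by
  simp [sharpMap, negZeroProduct_zero]

theorem countingMax_sharpMap_le (hm : 1 ≤ m) (hρ0 : 0 < ρ) (hρ1 : ρ < 1) {r : ℝ} (hr : 0 < r) :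
    countingMax (sharpMap hm n ρ) r ≤ ρ⁻¹ * r ^ ρ := by
  refine countingMax_le (by positivity) fun j ζ hζ => ?_
  exact logCounting_negZeroProduct_le hρ0 hρ1 (c := ζ ⟨0, hm⟩)
    ((PiLp.norm_apply_le ζ _).trans hζ.le) hr

theorem sharpMap_single (hm : 1 ≤ m) (z : ℂ) (j : Fin n) :
    sharpMap hm n ρ (z • EuclideanSpace.single ⟨0, hm⟩ 1) j = negZeroProduct ρ z := by
  simp [sharpMap]

theorem norm_negZeroProduct_le_modulusMax (hm : 1 ≤ m) (hn : 1 ≤ n) (hρ0 : 0 < ρ) (hρ1 : ρ < 1)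
    {r : ℝ} (hr : 0 < r) : ‖negZeroProduct ρ r‖ ≤ modulusMax (sharpMap hm n ρ) r := by
  have := norm_compSlice_le_modulusMax (differentiable_sharpMap (n := n) hm hρ0 hρ1) ⟨0, hn⟩
    (ζ := EuclideanSpace.single ⟨0, hm⟩ 1) (by simp) (r : ℂ)
  rwa [compSlice, sharpMap_single, Complex.norm_of_nonneg hr.le] at this

theorem norm_negZeroProduct_le_maxModulus (hm : 1 ≤ m) (hn : 1 ≤ n) (hρ0 : 0 < ρ) (hρ1 : ρ < 1)
    {r : ℝ} (hr : 0 < r) : ‖negZeroProduct ρ r‖ ≤ maxModulus (sharpMap hm n ρ) r := by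
  have h1 := norm_le_maxModulus (differentiable_sharpMap (n := n) hm hρ0 hρ1).continuous
    ((r : ℂ) • EuclideanSpace.single ⟨0, hm⟩ (1 : ℂ))
  have h2 := PiLp.norm_apply_le (sharpMap hm n ρ
    ((r : ℂ) • EuclideanSpace.single ⟨0, hm⟩ (1 : ℂ))) ⟨0, hn⟩
  rw [sharpMap_single] at h2
  refine h2.trans (h1.trans_eq ?_)
  rw [norm_smul, Complex.norm_of_nonneg hr.le]
  simp

theorem maxModulus_sharpMap_le (hm : 1 ≤ m) (hρ0 : 0 < ρ) (hρ1 : ρ < 1) (r : ℝ) :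
    maxModulus (sharpMap hm n ρ) r ≤ √n * Real.exp (ρ⁻¹ * (gammaConst ρ * r ^ ρ)) := by
  refine maxModulus_le (by positivity) fun w hw => ?_
  have h1 : ‖sharpMap hm n ρ w‖ = √n * ‖negZeroProduct ρ (w ⟨0, hm⟩)‖ := by
    rw [EuclideanSpace.norm_eq]
    simp [sharpMap]
  rw [h1]
  refine mul_le_mul_of_nonneg_left ((norm_negZeroProduct_le hρ0 hρ1 _).trans ?_) (by positivity)
  have hC := gammaConst_pos hρ0.le hρ1
  have hw0 : ‖w ⟨0, hm⟩‖ ≤ r := hw ▸ PiLp.norm_apply_le w _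
  gcongr

theorem growthRatio_sharpMap_le (hm : 1 ≤ m) (hn : 1 ≤ n) (hρ0 : 0 < ρ) (hρ1 : ρ < 1) :
    growthRatio (sharpMap hm n ρ)
      ≤ ((Real.sin (Real.pi * ρ) / (Real.pi * ρ) : ℝ) : EReal) := by
  have hC := gammaConst_pos hρ0.le hρ1
  have hdiv := tendsto_growthMinorant_div hρ0
  have hσ : Real.sin (Real.pi * ρ) / (Real.pi * ρ) = ρ⁻¹ / (ρ⁻¹ * gammaConst ρ) := by
    rw [gammaConst_eq hρ0]
    field_simp
  have hlim : Tendsto (fun r => ((ρ⁻¹ / (growthMinorant ρ r / r ^ ρ) : ℝ) : EReal)) atTop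
      (𝓝 ((Real.sin (Real.pi * ρ) / (Real.pi * ρ) : ℝ) : EReal)) := by
    rw [hσ]
    exact (continuous_coe_real_ereal.tendsto _).comp
      (tendsto_const_nhds.div hdiv (by positivity))
  rw [← hlim.limsup_eq, growthRatio]
  refine limsup_le_limsup ?_
  filter_upwards [eventually_gt_atTop 0,
    hdiv.eventually_const_lt (show 0 < ρ⁻¹ * gammaConst ρ by positivity)] with r hr hpos
  have hrρ : 0 < r ^ ρ := Real.rpow_pos_of_pos hr _
  have hmin : 0 < growthMinorant ρ r := (div_pos_iff_of_pos_right hrρ).1 hpos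
  have h1 := growthMinorant_le hρ0 hρ1 hr
  have hg : 0 < ‖negZeroProduct ρ r‖ := by
    by_contra! h
    rw [le_antisymm h (norm_nonneg _), Real.log_zero] at h1
    linarith
  have h2 := h1.trans (Real.log_le_log hg
    (norm_negZeroProduct_le_modulusMax (n := n) hm hn hρ0 hρ1 hr))
  rw [EReal.coe_le_coe_iff, div_div_eq_mul_div]
  exact div_le_div₀ (by positivity) (countingMax_sharpMap_le hm hρ0 hρ1 hr) hmin h2

theorem entireOrder_sharpMap (hm : 1 ≤ m) (hn : 1 ≤ n) (hρ0 : 0 < ρ) (hρ1 : ρ < 1) :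
    entireOrder (sharpMap hm n ρ) = (ρ : EReal) := by
  have hC := gammaConst_pos hρ0.le hρ1
  have hdiv := tendsto_growthMinorant_div hρ0
  set A : ℝ := ρ⁻¹ * gammaConst ρ / 2 with hA
  set B : ℝ := ρ⁻¹ * gammaConst ρ + 1 with hB
  have hA0 : 0 < A := by positivity
  have hB0 : 0 < B := by positivity
  have hn0 : 0 < √(n : ℝ) := Real.sqrt_pos.2 (by exact_mod_cast hn)
  have hbound : ∀ᶠ r in atTop, A * r ^ ρ ≤ Real.log (maxModulus (sharpMap hm n ρ) r) ∧
      Real.log (maxModulus (sharpMap hm n ρ) r) ≤ B * r ^ ρ := by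
    filter_upwards [eventually_gt_atTop 0, hdiv.eventually_const_lt (show A < _ by
      rw [hA]; exact half_lt_self (by positivity)),
      (tendsto_rpow_atTop hρ0).eventually_ge_atTop (Real.log √n)] with r hr h1 h2
    have hrρ : 0 < r ^ ρ := Real.rpow_pos_of_pos hr _
    rw [lt_div_iff₀ hrρ] at h1
    have h3 := growthMinorant_le hρ0 hρ1 hr
    have hg : 0 < ‖negZeroProduct ρ r‖ := by
      by_contra! h
      rw [le_antisymm h (norm_nonneg _), Real.log_zero] at h3
      have : 0 < A * r ^ ρ := by positivity
      linarith
    have h4 := norm_negZeroProduct_le_maxModulus (n := n) hm hn hρ0 hρ1 hr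
    refine ⟨h1.le.trans (h3.trans (Real.log_le_log hg h4)), ?_⟩
    refine (Real.log_le_log (hg.trans_le h4) (maxModulus_sharpMap_le hm hρ0 hρ1 r)).trans ?_
    rw [Real.log_mul hn0.ne' (Real.exp_pos _).ne', Real.log_exp, hB]
    linarith
  have haux : ∀ D : ℝ, 0 < D →
      Tendsto (fun r : ℝ => Real.log (D * r ^ ρ) / Real.log r) atTop (𝓝 ρ) := by
    intro D hD
    have h1 : Tendsto (fun r : ℝ => Real.log D / Real.log r + ρ) atTop (𝓝 (0 + ρ)) :=
      (tendsto_const_nhds.div_atTop Real.tendsto_log_atTop).add_const ρ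
    rw [zero_add] at h1
    refine h1.congr' ?_
    filter_upwards [eventually_gt_atTop 1] with r hr
    have hr0 : 0 < r := by linarith
    have hlog : Real.log r ≠ 0 := (Real.log_pos hr).ne'
    rw [Real.log_mul hD.ne' (Real.rpow_pos_of_pos hr0 _).ne', Real.log_rpow hr0]
    field_simp
  have hlim : Tendsto (fun r : ℝ => Real.log (Real.log (maxModulus (sharpMap hm n ρ) r))
      / Real.log r) atTop (𝓝 ρ) := by
    refine tendsto_of_tendsto_of_tendsto_of_le_of_le' (haux A hA0) (haux B hB0) ?_ ?_
    all_goals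
      filter_upwards [hbound, eventually_gt_atTop 1] with r hr h1
      have hlog : 0 < Real.log r := Real.log_pos h1
      have hArρ : 0 < A * r ^ ρ := mul_pos hA0 (Real.rpow_pos_of_pos (by linarith) _)
    · exact div_le_div_of_nonneg_right (Real.log_le_log hArρ hr.1) hlog.le
    · exact div_le_div_of_nonneg_right (Real.log_le_log (hArρ.trans_le hr.1) hr.2) hlog.le
  exact ((continuous_coe_real_ereal.tendsto ρ).comp hlim).limsup_eq

end

/-- The lower bound for every entire map of order `ρ` with all components `1` at the origin, and
its sharpness: for all `m`, `n`, `ρ` the bound is attained by such a map. -/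
theorem theorem2 (m n : ℕ) (hm : 1 ≤ m) (hn : 1 ≤ n) (ρ : ℝ) (hρ0 : 0 < ρ) (hρ1 : ρ < 1) :
    (∀ f : EuclideanSpace ℂ (Fin m) → EuclideanSpace ℂ (Fin n),
      Differentiable ℂ f → (∀ j, f 0 j = 1) → entireOrder f = (ρ : EReal) →
        ((Real.sin (Real.pi * ρ) / (Real.pi * ρ) : ℝ) : EReal) ≤ growthRatio f) ∧
    (∃ f : EuclideanSpace ℂ (Fin m) → EuclideanSpace ℂ (Fin n),
      Differentiable ℂ f ∧ (∀ j, f 0 j = 1) ∧ entireOrder f = (ρ : EReal) ∧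
        growthRatio f = ((Real.sin (Real.pi * ρ) / (Real.pi * ρ) : ℝ) : EReal)) := by
  refine ⟨fun f hf h0 hord => sin_div_le_growthRatio hm hn hρ0 hρ1 hf h0 hord,
    sharpMap hm n ρ, differentiable_sharpMap hm hρ0 hρ1, sharpMap_zero hm,
    entireOrder_sharpMap hm hn hρ0 hρ1,
    le_antisymm (growthRatio_sharpMap_le hm hn hρ0 hρ1) ?_⟩
  exact sin_div_le_growthRatio hm hn hρ0 hρ1 (differentiable_sharpMap hm hρ0 hρ1)
    (sharpMap_zero hm) (entireOrder_sharpMap hm hn hρ0 hρ1)
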